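/- Let $n\ge 0$ and $[n+1]=\{1,\dots,n+1\}$. A building set on $[n+1]$ is a collection $B$ of nonempty subsets of $[n+1]$ that contains all singletons $\{i\}$ and contains $S\cup T$ whenever $S,T\in B$ and $S\cap T\ne\emptyset$; it is connected if $[n+1]\in B$. Its nestohedron is the Minkowski sum $P_B=\sum_{S\in B}\operatorname{conv}\{e_i: i\in S\}\subset\mathbb R^{n+1}$. A polytope is flag if any collection of its pairwise intersecting facets has a nonempty intersection. For a simple polytope $P$ and a nonempty proper face $G=\{x\in P: l(x)=c\}$, where $l$ is linear with $l\le c$ on $P$, shaving $G$ means replacing $P$ by $\{x\in P: l(x)\le c-\varepsilon\}$, where $\varepsilon>0$ is so small that $l(v)<c-\varepsilon$ for every vertex $v$ of $P$ outside $G$. Let $B_1\subsetneq B_3$ be connected building sets on $[n+1]$ such that $P_{B_1}$ and $P_{B_3}$ are flag. Then there is a connected building set $B_2$ with $B_1\subsetneq B_2\subseteq B_3$ such that $P_{B_2}$ is, up to combinatorial equivalence (isomorphism of face posets), obtained from $P_{B_1}$ by finitely many successive shavings of faces of codimension $2$. Moreover, for every inclusion-minimal element $S$ of $B_3\setminus B_1$,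 the closure of $B_1\cup\{S\}$, i.e. the smallest building set containing $B_1\cup\{S\}$, is such a $B_2$. -/

import Mathlib

open scoped Pointwise

section Polytopes

variable {E : Type*} [AddCommGroup E] [Module ℝ E] [TopologicalSpace E]

/-- The dimension of a convex set: the dimension of its affine hull. -/
noncomputable def polyDim (P : Set E) : ℕ :=
  Module.finrank ℝ (vectorSpan ℝ P)

/-- A (nonempty) convex polytope: the convex hull of a nonempty finite set of points. -/
def IsPolytope (P : Set E) : Prop :=
  ∃ s : Finset E, s.Nonempty ∧ P = convexHull ℝ (s : Set E)

/-- A facet of `P`: a nonempty face of codimension one.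
Faces are the exposed subsets (the empty set and `P` itself included). -/
def IsFacet (P F : Set E) : Prop :=
  IsExposed ℝ P F ∧ F.Nonempty ∧ polyDim F + 1 = polyDim P

/-- A polytope is simple if every vertex lies in exactly `dim P` facets. -/
def IsSimplePolytope (P : Set E) : Prop :=
  IsPolytope P ∧
    ∀ v ∈ P.extremePoints ℝ, {F : Set E | IsFacet P F ∧ v ∈ F}.encard = (polyDim P : ℕ∞)

/-- A polytope is flag if any collection of pairwise intersecting facets
has a common point (in `P`). -/
def IsFlagPolytope (P : Set E) : Prop :=
  IsPolytope P ∧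
    ∀ 𝓕 : Set (Set E), (∀ F ∈ 𝓕, IsFacet P F) →
      (∀ F ∈ 𝓕, ∀ G ∈ 𝓕, (F ∩ G).Nonempty) → (P ∩ ⋂₀ 𝓕).Nonempty

/-- Combinatorial equivalence: the face posets, ordered by inclusion, are isomorphic. -/
def CombinatoriallyEquivalent {E' : Type*} [AddCommGroup E'] [Module ℝ E'] [TopologicalSpace E']
    (P : Set E) (Q : Set E') : Prop :=
  Nonempty ({F : Set E // IsExposed ℝ P F} ≃o {F : Set E' // IsExposed ℝ Q F})

/-- `Q` is obtained from the simple polytope `P` by shaving the nonempty face `G`: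
`l ≤ c` on `P` with equality exactly on `G`, and `Q` is cut out of `P` by `l ≤ c - ε`,
where `ε > 0` is so small that every vertex of `P` outside `G` satisfies `l < c - ε`. -/
def IsFaceShaving (P G Q : Set E) : Prop :=
  IsSimplePolytope P ∧ G.Nonempty ∧
    ∃ (l : StrongDual ℝ E) (c ε : ℝ), 0 < ε ∧
      (∀ x ∈ P, l x ≤ c) ∧
      G = {x ∈ P | l x = c} ∧
      (∀ v ∈ P.extremePoints ℝ, v ∉ G → l v < c - ε) ∧
      Q = {x ∈ P | l x ≤ c - ε}

/-- `Q` is obtained from `P` by shaving one face of codimension two. -/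
def IsCodimTwoShaving (P Q : Set E) : Prop :=
  ∃ G : Set E, polyDim G + 2 = polyDim P ∧ IsFaceShaving P G Q

/-- `Q` is, up to combinatorial equivalence, the result of a finite sequence of successive
shavings of codimension-two faces that starts from `P`. -/
def ObtainedByCodimTwoShavings (P Q : Set E) : Prop :=
  ∃ R : Set E, Relation.ReflTransGen IsCodimTwoShaving P R ∧ CombinatoriallyEquivalent R Q

end Polytopes

section BuildingSets

variable {n : ℕ}

/-- Building sets on the `(n+1)`-element set `Fin (n + 1)`. -/
structure IsBuildingSet (B : Finset (Finset (Fin (n + 1)))) : Prop where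
  nonempty_of_mem : ∀ S ∈ B, S.Nonempty
  singleton_mem : ∀ i : Fin (n + 1), {i} ∈ B
  union_mem : ∀ S ∈ B, ∀ T ∈ B, (S ∩ T).Nonempty → S ∪ T ∈ B

/-- A connected building set: it contains the whole ground set. -/
def IsConnectedBuildingSet (B : Finset (Finset (Fin (n + 1)))) : Prop :=
  IsBuildingSet B ∧ Finset.univ ∈ B

/-- `B` is the closure of `A`: the least building set (for inclusion) that contains `A`. -/
def IsBuildingClosure (A B : Finset (Finset (Fin (n + 1)))) : Prop :=
  IsLeast {C : Finset (Finset (Fin (n + 1))) | IsBuildingSet C ∧ A ⊆ C} B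

/-- The simplex `conv {e_i : i ∈ S}` in `ℝ^(n+1)`. -/
def coordSimplex (S : Finset (Fin (n + 1))) : Set (Fin (n + 1) → ℝ) :=
  convexHull ℝ ((fun i : Fin (n + 1) => (Pi.single i 1 : Fin (n + 1) → ℝ)) '' (S : Set (Fin (n + 1))))

/-- The nestohedron: the Minkowski sum of the simplices `conv {e_i : i ∈ S}`, `S ∈ B`. -/
noncomputable def nestohedron (B : Finset (Finset (Fin (n + 1)))) : Set (Fin (n + 1) → ℝ) :=
  ∑ S ∈ B, coordSimplex S

end BuildingSets

/-! For positive weights `w` on `B`, let g(U) be the total weight of the members of `B` inside U.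
The polytope ∑ x = g([n+1]), ∑_{i ∈ S} x i ≥ g(S) for S ∈ B, is a weighted version of the
nestohedron, and weights 1 give the nestohedron itself (`nestohedron_eq_subsetSumPolytope`). Its
nonempty faces are recorded by the families of tight sets, which are exactly the nested families of
`B` (`tightSets_image_subsetSumPolytope`). Hence the combinatorial type does not depend on the
weights, and weights may be adjusted freely along a chain of shavings.

Let T = I ⊔ J with I, J ∈ B and T ∉ B. No member of `B` inside T meets both I and J, so g(T) = g(I)
+ g(J): the inequality for T follows from those for I and J, and is tight precisely on the
codimension-two face where both are. Raising its bound by ε shaves this face, and Möbius inversion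
shows that the result is a weighted nestohedron of `insert T B` (`exists_isCodimTwoShaving`).

Flagness of the larger nestohedron splits a minimal S ∈ B₃ \ B₁ as I ⊔ J inside B₃
(`exists_disjoint_union_of_isFlagPolytope`), and minimality puts I and J in B₁. Every new member of
the closure of B₁ ∪ {S} is then again a disjoint union of two members of B₁
(`exists_isBuildingClosure_insert`). Adjoining the new members by decreasing cardinality keeps a
building set at each stage, and each stage is one shaving. -/

/-! ### Faces of polytopes given by subset-sum inequalities -/

section SubsetSumPolytopes

variable {n : ℕ}

/-- The polytope cut out of the hyperplane `∑ x i = g univ` by the inequalities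
`g S ≤ ∑ i ∈ S, x i`, `S ∈ B`. -/
def subsetSumPolytope (B : Finset (Finset (Fin (n + 1)))) (g : Finset (Fin (n + 1)) → ℝ) :
    Set (Fin (n + 1) → ℝ) :=
  {x | ∑ i, x i = g Finset.univ ∧ ∀ S ∈ B, g S ≤ ∑ i ∈ S, x i}

open Classical in
/-- The members of `B` whose inequality is an equality at `x`. -/
noncomputable def tightSets (B : Finset (Finset (Fin (n + 1)))) (g : Finset (Fin (n + 1)) → ℝ)
    (x : Fin (n + 1) → ℝ) : Finset (Finset (Fin (n + 1))) :=
  B.filter fun S => ∑ i ∈ S, x i = g S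

/-- The face of the points at which all the members of `N` are tight. -/
def tightFace (B : Finset (Finset (Fin (n + 1)))) (g : Finset (Fin (n + 1)) → ℝ)
    (N : Finset (Finset (Fin (n + 1)))) : Set (Fin (n + 1) → ℝ) :=
  {y ∈ subsetSumPolytope B g | N ⊆ tightSets B g y}

variable {B : Finset (Finset (Fin (n + 1)))} {g : Finset (Fin (n + 1)) → ℝ}

lemma mem_tightSets {x : Fin (n + 1) → ℝ} {S : Finset (Fin (n + 1))} :
    S ∈ tightSets B g x ↔ S ∈ B ∧ ∑ i ∈ S, x i = g S := by
  simp [tightSets]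

lemma univ_mem_tightSets (hB : Finset.univ ∈ B) {x : Fin (n + 1) → ℝ}
    (hx : x ∈ subsetSumPolytope B g) : Finset.univ ∈ tightSets B g x :=
  mem_tightSets.2 ⟨hB, hx.1⟩

lemma convex_subsetSumPolytope : Convex ℝ (subsetSumPolytope B g) := by
  intro x hx y hy a b ha hb hab
  have key : ∀ S : Finset (Fin (n + 1)),
      ∑ i ∈ S, (a • x + b • y) i = a * ∑ i ∈ S, x i + b * ∑ i ∈ S, y i := by
    intro S
    simp [Finset.sum_add_distrib, Finset.mul_sum]
  refine ⟨?_, fun S hS => ?_⟩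
  · rw [key, hx.1, hy.1, ← add_mul, hab, one_mul]
  · rw [key]
    calc g S = a * g S + b * g S := by rw [← add_mul, hab, one_mul]
      _ ≤ _ := add_le_add (mul_le_mul_of_nonneg_left (hx.2 S hS) ha)
        (mul_le_mul_of_nonneg_left (hy.2 S hS) hb)

lemma isClosed_subsetSumPolytope : IsClosed (subsetSumPolytope B g) := by
  have : subsetSumPolytope B g = {x | ∑ i, x i = g Finset.univ} ∩
      ⋂ S ∈ B, {x | g S ≤ ∑ i ∈ S, x i} := by
    ext x; simp [subsetSumPolytope]
  rw [this]
  refine (isClosed_eq (by fun_prop) (by fun_prop)).inter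
    (isClosed_biInter fun S _ => isClosed_le (by fun_prop) (by fun_prop))

lemma isCompact_subsetSumPolytope (hB : ∀ i, {i} ∈ B) : IsCompact (subsetSumPolytope B g) := by
  refine (isCompact_Icc (a := fun i : Fin (n + 1) => g {i})
    (b := fun i => g Finset.univ - ∑ j ∈ Finset.univ.erase i, g {j})).of_isClosed_subset
    isClosed_subsetSumPolytope ?_
  intro x hx
  have h : ∀ i, g {i} ≤ x i := fun i => by simpa using hx.2 {i} (hB i)
  refine ⟨h, fun i => ?_⟩
  have h1 := hx.1
  rw [← Finset.add_sum_erase _ _ (Finset.mem_univ i)] at h1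
  have h2 : ∑ j ∈ Finset.univ.erase i, g {j} ≤ ∑ j ∈ Finset.univ.erase i, x j :=
    Finset.sum_le_sum fun j _ => h j
  show x i ≤ _
  linarith

lemma tightFace_subset {N : Finset (Finset (Fin (n + 1)))} :
    tightFace B g N ⊆ subsetSumPolytope B g := fun _ h => h.1

lemma mem_tightFace_self {x : Fin (n + 1) → ℝ} (hx : x ∈ subsetSumPolytope B g) :
    x ∈ tightFace B g (tightSets B g x) := ⟨hx, subset_rfl⟩

/-- A short step along `d` leaves the tight sums unchanged, and the finitely many slack inequalities
survive by continuity. -/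
lemma exists_pos_add_smul_mem (hB : Finset.univ ∈ B) {x d : Fin (n + 1) → ℝ}
    (hx : x ∈ subsetSumPolytope B g) (hd : ∀ S ∈ tightSets B g x, ∑ i ∈ S, d i = 0) :
    ∃ δ : ℝ, 0 < δ ∧ x + δ • d ∈ tightFace B g (tightSets B g x) := by
  have key : ∀ (δ : ℝ) (S : Finset (Fin (n + 1))),
      ∑ i ∈ S, (x + δ • d) i = ∑ i ∈ S, x i + δ * ∑ i ∈ S, d i := by
    intro δ S
    simp [Finset.sum_add_distrib, Finset.mul_sum]
  have hev : ∀ᶠ δ : ℝ in nhdsWithin 0 (Set.Ioi 0), ∀ S ∈ B,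
      g S ≤ ∑ i ∈ S, x i + δ * ∑ i ∈ S, d i := by
    refine (Filter.eventually_all_finset B).2 fun S hS => ?_
    by_cases hT : ∑ i ∈ S, x i = g S
    · simp [hd S (mem_tightSets.2 ⟨hS, hT⟩), hT]
    · have hlt : g S < ∑ i ∈ S, x i := lt_of_le_of_ne (hx.2 S hS) (Ne.symm hT)
      have hc : Filter.Tendsto (fun δ : ℝ => ∑ i ∈ S, x i + δ * ∑ i ∈ S, d i)
          (nhdsWithin 0 (Set.Ioi 0)) (nhds (∑ i ∈ S, x i + 0 * ∑ i ∈ S, d i)) :=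
        (Continuous.tendsto (by fun_prop) 0).mono_left nhdsWithin_le_nhds
      rw [zero_mul, add_zero] at hc
      exact (hc.eventually (lt_mem_nhds hlt)).mono fun _ h => h.le
  obtain ⟨δ, hδ, hpos⟩ := (hev.and self_mem_nhdsWithin).exists
  refine ⟨δ, hpos, ⟨?_, fun S hS => (key δ S).symm ▸ hδ S hS⟩, fun S hS => ?_⟩
  · rw [key, hd _ (univ_mem_tightSets hB hx), hx.1]; simp
  · rw [mem_tightSets] at hS ⊢
    rw [key, hd S (mem_tightSets.2 hS), hS.2]
    simp [hS.1]

lemma tightSets_midpoint {x y : Fin (n + 1) → ℝ} (hx : x ∈ subsetSumPolytope B g)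
    (hy : y ∈ subsetSumPolytope B g) :
    tightSets B g ((1 / 2 : ℝ) • x + (1 / 2 : ℝ) • y) ⊆ tightSets B g y := by
  intro S hS
  rw [mem_tightSets] at hS ⊢
  have h : ∑ i ∈ S, ((1 / 2 : ℝ) • x + (1 / 2 : ℝ) • y) i =
      1 / 2 * ∑ i ∈ S, x i + 1 / 2 * ∑ i ∈ S, y i := by
    simp [Finset.sum_add_distrib, Finset.mul_sum]
  have h1 := hx.2 S hS.1
  have h2 := hy.2 S hS.1
  exact ⟨hS.1, by linarith [hS.2]⟩

lemma exists_eq_tightFace (hB : Finset.univ ∈ B) {F : Set (Fin (n + 1) → ℝ)}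
    (hF : IsExposed ℝ (subsetSumPolytope B g) F) (hne : F.Nonempty) :
    ∃ x ∈ F, x ∈ subsetSumPolytope B g ∧ F = tightFace B g (tightSets B g x) := by
  have hconv : Convex ℝ F := hF.convex convex_subsetSumPolytope
  have hsub : F ⊆ subsetSumPolytope B g := hF.subset
  obtain ⟨l, hl⟩ := hF hne
  -- A point of `F` with fewest tight sets plays the role of a relative interior point: passing to a
  -- midpoint can only lose tight sets, so those of `x` are tight on all of `F`.
  have hwf : ∃ x ∈ F, ∀ y ∈ F, (tightSets B g x).card ≤ (tightSets B g y).card := by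
    obtain ⟨x, hx, hmin⟩ := (measure fun x => (tightSets B g x).card).wf.has_min F hne
    exact ⟨x, hx, fun y hy => not_lt.1 (hmin y hy)⟩
  obtain ⟨x, hxF, hmin⟩ := hwf
  refine ⟨x, hxF, hsub hxF, Set.Subset.antisymm (fun y hy => ⟨hsub hy, ?_⟩) fun y hy => ?_⟩
  · have hm : (1 / 2 : ℝ) • x + (1 / 2 : ℝ) • y ∈ F :=
      hconv hxF hy (by norm_num) (by norm_num) (by norm_num)
    have h1 : tightSets B g ((1 / 2 : ℝ) • x + (1 / 2 : ℝ) • y) ⊆ tightSets B g x := by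
      rw [add_comm ((1 / 2 : ℝ) • x)]
      exact tightSets_midpoint (hsub hy) (hsub hxF)
    rw [← Finset.eq_of_subset_of_card_le h1 (hmin _ hm)]
    exact tightSets_midpoint (hsub hxF) (hsub hy)
  -- The segment from `y` to `x` can be prolonged beyond `x` inside the polytope. As `l` is maximal
  -- at `x`, it cannot be smaller at `y`.
  · obtain ⟨δ, hδ, hmem⟩ := exists_pos_add_smul_mem (g := g) hB (hsub hxF) (d := x - y) (by
      intro S hS
      have h1 := (mem_tightSets.1 hS).2
      have h2 := (mem_tightSets.1 (hy.2 hS)).2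
      simp [h1, h2])
    have hxm := hxF
    rw [hl] at hxm ⊢
    have h3 := hxm.2 _ hmem.1
    simp only [map_add, map_smul, map_sub, smul_eq_mul] at h3
    refine ⟨hy.1, fun z hz => (hxm.2 z hz).trans ?_⟩
    by_contra hcon
    have := mul_pos hδ (sub_pos.2 (not_le.1 hcon))
    linarith

lemma isExposed_tightFace {x : Fin (n + 1) → ℝ} (hx : x ∈ subsetSumPolytope B g) :
    IsExposed ℝ (subsetSumPolytope B g) (tightFace B g (tightSets B g x)) := by
  intro _
  -- Minus the sum of the tight functionals: it is maximal exactly where each of them attains its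
  -- lower bound.
  let l : StrongDual ℝ (Fin (n + 1) → ℝ) :=
    -∑ S ∈ tightSets B g x, ∑ i ∈ S, ContinuousLinearMap.proj i
  have hl : ∀ y, l y = -∑ S ∈ tightSets B g x, ∑ i ∈ S, y i := by
    intro y; simp [l]
  have hle : ∀ y ∈ subsetSumPolytope B g, ∑ S ∈ tightSets B g x, g S ≤
      ∑ S ∈ tightSets B g x, ∑ i ∈ S, y i := fun y hy =>
    Finset.sum_le_sum fun S hS => hy.2 S (mem_tightSets.1 hS).1
  have hex : ∑ S ∈ tightSets B g x, ∑ i ∈ S, x i = ∑ S ∈ tightSets B g x, g S :=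
    Finset.sum_congr rfl fun S hS => (mem_tightSets.1 hS).2
  refine ⟨l, Set.Subset.antisymm (fun y hy => ⟨hy.1, fun z hz => ?_⟩) fun y hy => ⟨hy.1, ?_⟩⟩
  · rw [hl, hl, neg_le_neg_iff]
    refine le_trans (le_of_eq ?_) (hle z hz)
    exact Finset.sum_congr rfl fun S hS => (mem_tightSets.1 (hy.2 hS)).2
  · have h1 := hy.2 x hx
    rw [hl, hl, neg_le_neg_iff, hex] at h1
    have h2 := (Finset.sum_eq_sum_iff_of_le
      (fun S hS => hy.1.2 S (mem_tightSets.1 hS).1)).1 (le_antisymm (hle y hy.1) h1)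
    exact fun S hS => mem_tightSets.2 ⟨(mem_tightSets.1 hS).1, (h2 S hS).symm⟩

lemma tightFace_subset_tightFace {x y : Fin (n + 1) → ℝ} (hx : x ∈ subsetSumPolytope B g) :
    tightFace B g (tightSets B g x) ⊆ tightFace B g (tightSets B g y) ↔
      tightSets B g y ⊆ tightSets B g x :=
  ⟨fun h => (h (mem_tightFace_self hx)).2, fun h _ hz => ⟨hz.1, h.trans hz.2⟩⟩

/-- Otherwise the segment from `y` prolonged beyond `x` would have `x` in its interior. It follows
that a vertex is determined by its tight sets, whence there are finitely many. -/
lemma eq_of_mem_tightFace_of_extreme (hB : Finset.univ ∈ B) {x y : Fin (n + 1) → ℝ}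
    (hx : x ∈ (subsetSumPolytope B g).extremePoints ℝ)
    (hy : y ∈ tightFace B g (tightSets B g x)) : y = x := by
  obtain ⟨δ, hδ, hmem⟩ := exists_pos_add_smul_mem (g := g) hB hx.1 (d := x - y) (by
    intro S hS
    have h1 := (mem_tightSets.1 hS).2
    have h2 := (mem_tightSets.1 (hy.2 hS)).2
    simp [h1, h2])
  refine hx.2 hy.1 hmem.1 ⟨δ / (1 + δ), 1 / (1 + δ), by positivity, by positivity,
    by field_simp; ring, ?_⟩
  ext i
  simp
  field_simp
  ring

lemma finite_extremePoints_subsetSumPolytope (hB : Finset.univ ∈ B) :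
    ((subsetSumPolytope B g).extremePoints ℝ).Finite := by
  refine Set.Finite.of_finite_image (f := tightSets B g) ((B.powerset.finite_toSet).subset ?_) ?_
  · rintro _ ⟨x, _, rfl⟩
    simp only [Finset.coe_powerset, Set.mem_preimage, Set.mem_powerset_iff, Finset.coe_subset]
    exact fun S hS => (mem_tightSets.1 hS).1
  · intro x hx y hy hxy
    exact (eq_of_mem_tightFace_of_extreme hB hy ⟨hx.1, hxy.ge⟩)

lemma isPolytope_subsetSumPolytope (hB : Finset.univ ∈ B) (hs : ∀ i, {i} ∈ B)
    (hne : (subsetSumPolytope B g).Nonempty) : IsPolytope (subsetSumPolytope B g) := by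
  have hfin := finite_extremePoints_subsetSumPolytope (g := g) hB
  have hc := isCompact_subsetSumPolytope (g := g) hs
  refine ⟨hfin.toFinset, ?_, ?_⟩
  · simpa using hc.extremePoints_nonempty hne
  · rw [hfin.coe_toFinset, ← (hfin.isCompact_convexHull ℝ).isClosed.closure_eq,
      closure_convexHull_extremePoints hc convex_subsetSumPolytope]

/-- The face poset of a subset sum polytope is determined by the family of its tight sets. -/
lemma combinatoriallyEquivalent_of_tightSets {g' : Finset (Fin (n + 1)) → ℝ}
    (hB : Finset.univ ∈ B)
    (h : tightSets B g '' subsetSumPolytope B g = tightSets B g' '' subsetSumPolytope B g') :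
    CombinatoriallyEquivalent (subsetSumPolytope B g) (subsetSumPolytope B g') := by
  classical
  -- The face with tight family N goes to the face of the other polytope with the same N, and the
  -- empty face to the empty face. Stating this for arbitrary `g₁`, `g₂` yields both directions.
  have main : ∀ g₁ g₂ : Finset (Fin (n + 1)) → ℝ,
      tightSets B g₁ '' subsetSumPolytope B g₁ = tightSets B g₂ '' subsetSumPolytope B g₂ →
      ∃ φ : {F // IsExposed ℝ (subsetSumPolytope B g₁) F} →
        {F // IsExposed ℝ (subsetSumPolytope B g₂) F},
        (∀ F, F.1 = ∅ → (φ F).1 = ∅) ∧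
        ∀ F, ∀ x ∈ subsetSumPolytope B g₁, F.1 = tightFace B g₁ (tightSets B g₁ x) →
          (φ F).1 = tightFace B g₂ (tightSets B g₁ x) := by
    intro g₁ g₂ h
    have hex : ∀ F : {F // IsExposed ℝ (subsetSumPolytope B g₁) F},
        ∃ F' : {F // IsExposed ℝ (subsetSumPolytope B g₂) F},
        (F.1 = ∅ → F'.1 = ∅) ∧
        ∀ x ∈ subsetSumPolytope B g₁, F.1 = tightFace B g₁ (tightSets B g₁ x) →
          F'.1 = tightFace B g₂ (tightSets B g₁ x) := by
      intro F
      rcases F.1.eq_empty_or_nonempty with he | hne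
      · refine ⟨⟨∅, fun h => absurd h (by simp)⟩, fun _ => rfl, fun x hx hF => ?_⟩
        exact absurd (hF ▸ mem_tightFace_self hx) (by simp [he])
      · obtain ⟨x, _, hx, hF⟩ := exists_eq_tightFace hB F.2 hne
        obtain ⟨y, hy, hxy⟩ : tightSets B g₁ x ∈ tightSets B g₂ '' subsetSumPolytope B g₂ :=
          h ▸ ⟨x, hx, rfl⟩
        refine ⟨⟨_, isExposed_tightFace hy⟩, fun h => absurd h hne.ne_empty, fun z hz hFz => ?_⟩
        have : tightSets B g₁ x = tightSets B g₁ z :=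
          Finset.Subset.antisymm ((tightFace_subset_tightFace hz).1 (hFz ▸ hF).le)
            ((tightFace_subset_tightFace hx).1 (hF ▸ hFz).le)
        simp only [hxy, this]
    choose φ h1 h2 using hex
    exact ⟨φ, h1, h2⟩
  obtain ⟨φ, hφ, hφ'⟩ := main g g' h
  obtain ⟨ψ, hψ, hψ'⟩ := main g' g h.symm
  have inv : ∀ (g₁ g₂ : Finset (Fin (n + 1)) → ℝ)
      (_ : tightSets B g₁ '' subsetSumPolytope B g₁ = tightSets B g₂ '' subsetSumPolytope B g₂)
      (φ : {F // IsExposed ℝ (subsetSumPolytope B g₁) F} →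
        {F // IsExposed ℝ (subsetSumPolytope B g₂) F})
      (ψ : {F // IsExposed ℝ (subsetSumPolytope B g₂) F} →
        {F // IsExposed ℝ (subsetSumPolytope B g₁) F}),
      (∀ F, F.1 = ∅ → (φ F).1 = ∅) →
      (∀ F, ∀ x ∈ subsetSumPolytope B g₁, F.1 = tightFace B g₁ (tightSets B g₁ x) →
          (φ F).1 = tightFace B g₂ (tightSets B g₁ x)) →
      (∀ F, F.1 = ∅ → (ψ F).1 = ∅) →
      (∀ F, ∀ x ∈ subsetSumPolytope B g₂, F.1 = tightFace B g₂ (tightSets B g₂ x) →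
          (ψ F).1 = tightFace B g₁ (tightSets B g₂ x)) →
      ∀ F, ψ (φ F) = F := by
    intro g₁ g₂ h φ ψ hφ hφ' hψ hψ' F
    apply Subtype.ext
    rcases F.1.eq_empty_or_nonempty with he | hne
    · rw [hψ _ (hφ _ he), he]
    · obtain ⟨x, _, hx, hF⟩ := exists_eq_tightFace hB F.2 hne
      obtain ⟨y, hy, hxy⟩ : tightSets B g₁ x ∈ tightSets B g₂ '' subsetSumPolytope B g₂ :=
        h ▸ ⟨x, hx, rfl⟩
      have := hφ' F x hx hF
      rw [← hxy] at this
      rw [hψ' _ y hy this, hF, hxy]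
  have mono : ∀ (g₁ g₂ : Finset (Fin (n + 1)) → ℝ)
      (φ : {F // IsExposed ℝ (subsetSumPolytope B g₁) F} →
        {F // IsExposed ℝ (subsetSumPolytope B g₂) F}),
      (∀ F, F.1 = ∅ → (φ F).1 = ∅) →
      (∀ F, ∀ x ∈ subsetSumPolytope B g₁, F.1 = tightFace B g₁ (tightSets B g₁ x) →
          (φ F).1 = tightFace B g₂ (tightSets B g₁ x)) → Monotone φ := by
    intro g₁ g₂ φ hφ hφ' F F' hFF'
    have hsub : F.1 ⊆ F'.1 := hFF'
    show (φ F).1 ⊆ (φ F').1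
    rcases F.1.eq_empty_or_nonempty with he | hne
    · rw [hφ _ he]
      exact Set.empty_subset _
    · obtain ⟨x, _, hx, hF⟩ := exists_eq_tightFace hB F.2 hne
      obtain ⟨y, _, hy, hF'⟩ := exists_eq_tightFace hB F'.2 (hne.mono hsub)
      rw [hφ' F x hx hF, hφ' F' y hy hF']
      rw [hF, hF', tightFace_subset_tightFace hx] at hsub
      exact fun z hz => ⟨hz.1, hsub.trans hz.2⟩
  exact ⟨Equiv.toOrderIso
    ⟨φ, ψ, inv _ _ h φ ψ hφ hφ' hψ hψ', inv _ _ h.symm ψ φ hψ hψ' hφ hφ'⟩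
    (mono _ _ φ hφ hφ') (mono _ _ ψ hψ hψ')⟩

end SubsetSumPolytopes

/-! ### Nested families and dimensions of faces -/

section NestedSets

variable {n : ℕ}

/-- Nested families of members of `B`, the whole ground set included: a union of members of the
family lies in `B` only if it is one of these members. -/
structure IsNestedFamily (B N : Finset (Finset (Fin (n + 1)))) : Prop where
  subset : N ⊆ B
  univ_mem : Finset.univ ∈ N
  sup_mem : ∀ A ⊆ N, A.sup id ∈ B → A.sup id ∈ A

variable {B N : Finset (Finset (Fin (n + 1)))} {g : Finset (Fin (n + 1)) → ℝ}

lemma IsNestedFamily.subset_or_subset (hB : IsBuildingSet B) (hN : IsNestedFamily B N)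
    {S T : Finset (Fin (n + 1))} (hS : S ∈ N) (hT : T ∈ N) (hST : (S ∩ T).Nonempty) :
    S ⊆ T ∨ T ⊆ S := by
  have h := hN.sup_mem {S, T} (by simp [Finset.insert_subset_iff, hS, hT])
    (by simpa using hB.union_mem S (hN.subset hS) T (hN.subset hT) hST)
  simp only [Finset.sup_insert, id_eq, Finset.sup_singleton, Finset.sup_eq_union,
    Finset.mem_insert, Finset.mem_singleton, Finset.union_eq_left, Finset.union_eq_right] at h
  exact h.symm

/-- A member of `B` is not covered by the members of a nested family that do not contain it. -/
lemma IsNestedFamily.exists_mem_forall (hB : IsBuildingSet B) (hN : IsNestedFamily B N)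
    {V : Finset (Fin (n + 1))} (hV : V ∈ B) : ∃ i ∈ V, ∀ T ∈ N, i ∈ T → V ⊆ T := by
  by_contra! hcon
  -- If the claim fails, the members of `N` that meet `V` without containing it cover `V`. Glued
  -- onto `V` one by one they show that their union is in `B`, so by nestedness this union is one of
  -- them and contains `V`, a contradiction.
  set A := N.filter fun T => (T ∩ V).Nonempty ∧ ¬V ⊆ T with hA
  have hVA : V ⊆ A.sup id := by
    intro i hi
    obtain ⟨T, hT, hiT, hVT⟩ := hcon i hi
    exact Finset.mem_sup.2 ⟨T, Finset.mem_filter.2 ⟨hT, ⟨i, Finset.mem_inter.2 ⟨hiT, hi⟩⟩, hVT⟩, hiT⟩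
  have hun : ∀ A' ⊆ A, V ∪ A'.sup id ∈ B := by
    intro A'
    induction A' using Finset.induction_on with
    | empty => intro _; simpa using hV
    | insert T A' _ ih =>
      intro h
      rw [Finset.insert_subset_iff] at h
      have hT := Finset.mem_filter.1 h.1
      have : V ∪ (insert T A').sup id = (V ∪ A'.sup id) ∪ T := by
        simp [Finset.sup_insert, Finset.union_comm, Finset.union_left_comm]
      rw [this]
      refine hB.union_mem _ (ih h.2) _ (hN.subset hT.1) ?_
      obtain ⟨i, hi⟩ := hT.2.1
      simp only [Finset.mem_inter] at hi
      exact ⟨i, by simp [hi.1, hi.2]⟩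
  have h1 := hun A subset_rfl
  rw [Finset.union_eq_right.2 hVA] at h1
  exact (Finset.mem_filter.1 (hN.sup_mem A (Finset.filter_subset _ _) h1)).2.2 hVA

/-- The incidence matrix of a family of sets. -/
def incidence (N : Finset (Finset (Fin (n + 1)))) : Matrix N (Fin (n + 1)) ℝ :=
  fun S i => if i ∈ S.1 then 1 else 0

lemma mem_ker_incidence {d : Fin (n + 1) → ℝ} :
    d ∈ LinearMap.ker (incidence N).mulVecLin ↔ ∀ S ∈ N, ∑ i ∈ S, d i = 0 := by
  rw [LinearMap.mem_ker, funext_iff]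
  simp [incidence, Matrix.mulVec, dotProduct]

/-- The matrix is triangular with respect to inclusion: each S ∈ N has an element i that lies in no
member of N other than the supersets of S. -/
lemma IsNestedFamily.linearIndependent_incidence (hB : IsBuildingSet B)
    (hN : IsNestedFamily B N) : LinearIndependent ℝ (incidence N).row := by
  classical
  rw [Fintype.linearIndependent_iff]
  intro c hc
  by_contra! hne
  obtain ⟨S, hS⟩ := hne
  -- A largest `S` with nonzero coefficient: in the column of its private element all other terms
  -- vanish.
  obtain ⟨S, hS, hmax⟩ := (measure fun S : N => n + 1 - S.1.card).wf.has_min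
    {S : N | c S ≠ 0} ⟨S, hS⟩
  obtain ⟨i, hiS, hi⟩ := hN.exists_mem_forall hB (hN.subset S.2)
  have h := congrFun hc i
  rw [Finset.sum_apply, Finset.sum_eq_single S] at h
  · apply hS
    simpa [incidence, Matrix.row, hiS] using h
  · intro T _ hTS
    by_cases hiT : i ∈ T.1
    · have hsub : S.1 ⊆ T.1 := hi T T.2 hiT
      have hlt : S.1.card < T.1.card :=
        Finset.card_lt_card (hsub.ssubset_of_ne fun h => hTS (Subtype.ext h.symm))
      have : c T = 0 := by
        by_contra hcT
        refine hmax T hcT ?_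
        have := Finset.card_le_univ T.1
        simp only [Fintype.card_fin] at this
        show n + 1 - T.1.card < n + 1 - S.1.card
        omega
      simp [this]
    · simp [incidence, Matrix.row, hiT]
  · simp

lemma vectorSpan_tightFace (hB : Finset.univ ∈ B) {x : Fin (n + 1) → ℝ}
    (hx : x ∈ subsetSumPolytope B g) :
    vectorSpan ℝ (tightFace B g (tightSets B g x)) =
      LinearMap.ker (incidence (tightSets B g x)).mulVecLin := by
  apply le_antisymm
  · rw [vectorSpan_def, Submodule.span_le]
    rintro _ ⟨y, hy, z, hz, rfl⟩
    rw [SetLike.mem_coe, mem_ker_incidence]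
    intro S hS
    have h1 := (mem_tightSets.1 (hy.2 hS)).2
    have h2 := (mem_tightSets.1 (hz.2 hS)).2
    simp [h1, h2]
  · intro d hd
    obtain ⟨δ, hδ, hmem⟩ := exists_pos_add_smul_mem (g := g) hB hx (mem_ker_incidence.1 hd)
    have h := vsub_mem_vectorSpan ℝ hmem (mem_tightFace_self hx)
    rw [vsub_eq_sub, add_sub_cancel_left] at h
    exact ((vectorSpan ℝ _).smul_mem_iff hδ.ne').1 h

/-- The directions of the face form the kernel of the incidence matrix, whose rows are independent;
rank-nullity finishes. -/
lemma polyDim_tightFace_add_card (hB : IsBuildingSet B) {x : Fin (n + 1) → ℝ}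
    (hx : x ∈ subsetSumPolytope B g) (hN : IsNestedFamily B (tightSets B g x)) :
    polyDim (tightFace B g (tightSets B g x)) + (tightSets B g x).card = n + 1 := by
  rw [polyDim, vectorSpan_tightFace (hN.subset hN.univ_mem) hx]
  have h1 := (hN.linearIndependent_incidence hB).rank_matrix
  have h2 := (incidence (tightSets B g x)).mulVecLin.finrank_range_add_finrank_ker
  rw [Matrix.rank] at h1
  rw [h1] at h2
  simp only [Fintype.card_coe, Module.finrank_fintype_fun_eq_card, Fintype.card_fin] at h2
  omega

end NestedSets

/-! ### Weighted nestohedra and their tight families -/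

section WeightedNestohedra

variable {n : ℕ}

/-- The total weight of the members of `B` inside `U`. -/
def lowerWeight (B : Finset (Finset (Fin (n + 1)))) (w : Finset (Fin (n + 1)) → ℝ)
    (U : Finset (Fin (n + 1))) : ℝ :=
  ∑ V ∈ B with V ⊆ U, w V

variable {B N : Finset (Finset (Fin (n + 1)))} {w : Finset (Fin (n + 1)) → ℝ}

/-- The defining inequalities of a weighted nestohedron extend to all subsets. -/
lemma lowerWeight_le_sum (hB : IsBuildingSet B) {x : Fin (n + 1) → ℝ}
    (hx : ∀ S ∈ B, lowerWeight B w S ≤ ∑ i ∈ S, x i) (U : Finset (Fin (n + 1))) :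
    lowerWeight B w U ≤ ∑ i ∈ U, x i := by
  induction U using Finset.strongInduction with
  | H U ih =>
    rcases U.eq_empty_or_nonempty with rfl | ⟨i, hi⟩
    · rw [lowerWeight, Finset.filter_false_of_mem]
      · simp
      · intro V hV h
        exact (hB.nonempty_of_mem V hV).ne_empty (Finset.subset_empty.1 h)
    -- For a largest member `V` inside `U`, every member inside `U` lies in `V` or is disjoint from
    -- it, so the weight splits over `V` and `U \ V`.
    · obtain ⟨V, hV, hmax⟩ := Finset.exists_max_image (B.filter (· ⊆ U)) Finset.card
        ⟨{i}, by simp [hB.singleton_mem, hi]⟩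
      simp only [Finset.mem_filter] at hV hmax
      have hVne := hB.nonempty_of_mem V hV.1
      have hsplit : lowerWeight B w U = lowerWeight B w V + lowerWeight B w (U \ V) := by
        rw [lowerWeight, lowerWeight, lowerWeight, ← Finset.sum_union]
        · congr 1
          ext T
          simp only [Finset.mem_filter, Finset.mem_union]
          refine ⟨fun h => ?_, ?_⟩
          · by_cases hd : (T ∩ V).Nonempty
            · left
              have h1 := hmax (T ∪ V) ⟨hB.union_mem T h.1 V hV.1 hd,
                Finset.union_subset h.2 hV.2⟩
              have h2 := Finset.eq_of_subset_of_card_le Finset.subset_union_right h1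
              exact ⟨h.1, h2 ▸ Finset.subset_union_left⟩
            · right
              refine ⟨h.1, Finset.subset_sdiff.2 ⟨h.2, ?_⟩⟩
              rwa [Finset.disjoint_iff_inter_eq_empty, ← Finset.not_nonempty_iff_eq_empty]
          · rintro (h | h)
            · exact ⟨h.1, h.2.trans hV.2⟩
            · exact ⟨h.1, h.2.trans Finset.sdiff_subset⟩
        · rw [Finset.disjoint_left]
          intro T h1 h2
          simp only [Finset.mem_filter] at h1 h2
          obtain ⟨j, hj⟩ := hB.nonempty_of_mem T h1.1
          exact (Finset.mem_sdiff.1 (h2.2 hj)).2 (h1.2 hj)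
      rw [hsplit, ← Finset.sum_sdiff hV.2, add_comm]
      exact add_le_add (ih _ (Finset.sdiff_ssubset hV.2 hVne)) (hx V hV.1)

/-- Supermodularity of `lowerWeight` for nonnegative weights, with the defect made explicit: it is
the weight of the members of `B` inside the union but in neither part. -/
lemma lowerWeight_union_add_inter (A C : Finset (Fin (n + 1))) :
    lowerWeight B w (A ∪ C) + lowerWeight B w (A ∩ C) =
      lowerWeight B w A + lowerWeight B w C +
        ∑ V ∈ B with V ⊆ A ∪ C ∧ ¬V ⊆ A ∧ ¬V ⊆ C, w V := by
  simp only [lowerWeight, Finset.sum_filter, ← Finset.sum_add_distrib]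
  refine Finset.sum_congr rfl fun V _ => ?_
  by_cases h1 : V ⊆ A
  · simp [h1, h1.trans Finset.subset_union_left, Finset.subset_inter_iff]
  · by_cases h2 : V ⊆ C
    · simp [h1, h2, h2.trans Finset.subset_union_right, Finset.subset_inter_iff]
    · simp [h1, h2, Finset.subset_inter_iff]

/-- The sets that are tight at a point of a weighted nestohedron form a nested family. -/
lemma isNestedFamily_tightSets (hB : IsConnectedBuildingSet B) (hw : ∀ V ∈ B, 0 < w V)
    {x : Fin (n + 1) → ℝ} (hx : x ∈ subsetSumPolytope B (lowerWeight B w)) :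
    IsNestedFamily B (tightSets B (lowerWeight B w) x) := by
  have hle := lowerWeight_le_sum hB.1 hx.2
  refine ⟨fun S hS => (mem_tightSets.1 hS).1, univ_mem_tightSets hB.2 hx, fun A hA hsup => ?_⟩
  -- Unions of tight sets are tight, by supermodularity. Equality leaves no room for the positive
  -- defect, so each member inside the union already lies in one of the sets.
  have key : ∀ A' ⊆ A, ∑ i ∈ A'.sup id, x i = lowerWeight B w (A'.sup id) ∧
      ∀ V ∈ B, V ⊆ A'.sup id → ∃ S ∈ A', V ⊆ S := by
    intro A'
    induction A' using Finset.induction_on with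
    | empty =>
      intro _
      have h0 : lowerWeight B w ∅ ≤ 0 := by simpa using hle ∅
      have h1 : 0 ≤ lowerWeight B w ∅ :=
        Finset.sum_nonneg fun V hV => (hw V (Finset.mem_filter.1 hV).1).le
      refine ⟨by simpa using le_antisymm h1 h0, fun V hV h => ?_⟩
      exact absurd (Finset.subset_empty.1 h) (hB.1.nonempty_of_mem V hV).ne_empty
    | insert S A' _ ih =>
      intro h
      rw [Finset.insert_subset_iff] at h
      obtain ⟨ih1, ih2⟩ := ih h.2
      have hS := (mem_tightSets.1 (hA h.1)).2
      simp only [Finset.sup_insert, id_eq, Finset.sup_eq_union]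
      have h1 := lowerWeight_union_add_inter (B := B) (w := w) S (A'.sup id)
      have h2 := Finset.sum_union_inter (s₁ := S) (s₂ := A'.sup id) (f := x)
      have h3 := hle (S ∪ A'.sup id)
      have h4 := hle (S ∩ A'.sup id)
      have h5 : ∀ V ∈ B.filter fun V => V ⊆ S ∪ A'.sup id ∧ ¬V ⊆ S ∧ ¬V ⊆ A'.sup id, 0 < w V :=
        fun V hV => hw V (Finset.mem_filter.1 hV).1
      have h6 := Finset.sum_nonneg fun V hV => (h5 V hV).le
      refine ⟨by linarith, fun V hV hVsub => ?_⟩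
      by_contra! hcon
      have hVS := hcon S (Finset.mem_insert_self _ _)
      have hVA : ¬V ⊆ A'.sup id := fun h => by
        obtain ⟨T, hT, hVT⟩ := ih2 V hV h
        exact hcon T (Finset.mem_insert_of_mem hT) hVT
      have := Finset.sum_pos h5 ⟨V, by simp [hV, hVsub, hVS, hVA]⟩
      linarith
  obtain ⟨S, hS, hsub⟩ := (key A subset_rfl).2 _ hsup subset_rfl
  rwa [Finset.Subset.antisymm hsub (Finset.le_sup (f := id) hS)]

/-- The members of `V` that lie in no member of `N` except for those that contain `V`. -/
def freeElements (N : Finset (Finset (Fin (n + 1)))) (V : Finset (Fin (n + 1))) :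
    Finset (Fin (n + 1)) :=
  V.filter fun i => ∀ T ∈ N, i ∈ T → V ⊆ T

/-- The barycenter of the face of the simplex on `V` that is spanned by the free elements. -/
noncomputable def freeBarycenter (N : Finset (Finset (Fin (n + 1)))) (V : Finset (Fin (n + 1)))
    (i : Fin (n + 1)) : ℝ :=
  if i ∈ freeElements N V then ((freeElements N V).card : ℝ)⁻¹ else 0

lemma freeBarycenter_mem_coordSimplex {V : Finset (Fin (n + 1))}
    (h : (freeElements N V).Nonempty) : freeBarycenter N V ∈ coordSimplex V := by
  have hc : ((freeElements N V).card : ℝ) ≠ 0 := by exact_mod_cast h.card_pos.ne'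
  have : freeBarycenter N V = ∑ i ∈ freeElements N V,
      ((freeElements N V).card : ℝ)⁻¹ • (Pi.single i 1 : Fin (n + 1) → ℝ) := by
    ext j
    simp [freeBarycenter, Finset.sum_apply, Pi.single_apply]
  rw [this]
  refine (convex_convexHull ℝ _).sum_mem (fun i _ => by positivity) (by simp [hc])
    fun i hi => subset_convexHull ℝ _ ⟨i, (Finset.mem_filter.1 hi).1, rfl⟩

lemma sum_eq_one_of_mem_coordSimplex {V : Finset (Fin (n + 1))} {p : Fin (n + 1) → ℝ}
    (hp : p ∈ coordSimplex V) :
    (∀ i, 0 ≤ p i) ∧ ∀ U, V ⊆ U → ∑ i ∈ U, p i = 1 := by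
  let C : Set (Fin (n + 1) → ℝ) := {p | (∀ i, 0 ≤ p i) ∧ ∀ U, V ⊆ U → ∑ i ∈ U, p i = 1}
  have hC : Convex ℝ C := by
    intro x hx y hy a b ha hb hab
    refine ⟨fun i => ?_, fun U hU => ?_⟩
    · exact add_nonneg (mul_nonneg ha (hx.1 i)) (mul_nonneg hb (hy.1 i))
    · have h1 := hx.2 U hU
      have h2 := hy.2 U hU
      simp [Finset.sum_add_distrib, ← Finset.mul_sum, h1, h2, hab]
  refine convexHull_min ?_ hC hp
  rintro _ ⟨i, hi, rfl⟩
  refine ⟨fun j => ?_, fun U hU => ?_⟩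
  · show 0 ≤ (Pi.single i 1 : Fin (n + 1) → ℝ) j
    rw [Pi.single_apply]
    split_ifs <;> norm_num
  · simp [Pi.single_apply, hU hi]

/-- A simplex on V ⊆ U contributes its full weight, so the last sum is the slack of the inequality
for `U`. -/
lemma sum_smul_eq_lowerWeight_add {p : Finset (Fin (n + 1)) → Fin (n + 1) → ℝ}
    (hp : ∀ V ∈ B, p V ∈ coordSimplex V)
    (U : Finset (Fin (n + 1))) :
    ∑ i ∈ U, (∑ V ∈ B, w V • p V) i =
      lowerWeight B w U + ∑ V ∈ B with ¬V ⊆ U, w V * ∑ i ∈ U, p V i := by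
  simp only [Finset.sum_apply, Pi.smul_apply, smul_eq_mul]
  rw [Finset.sum_comm, ← Finset.sum_filter_add_sum_filter_not B (· ⊆ U), lowerWeight]
  simp only [← Finset.mul_sum]
  congr 1
  refine Finset.sum_congr rfl fun V hV => ?_
  rw [Finset.mem_filter] at hV
  rw [(sum_eq_one_of_mem_coordSimplex (hp V hV.1)).2 U hV.2, mul_one]

lemma sum_smul_mem_subsetSumPolytope (hw : ∀ V ∈ B, 0 < w V)
    {p : Finset (Fin (n + 1)) → Fin (n + 1) → ℝ} (hp : ∀ V ∈ B, p V ∈ coordSimplex V) :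
    ∑ V ∈ B, w V • p V ∈ subsetSumPolytope B (lowerWeight B w) := by
  refine ⟨?_, fun S _ => ?_⟩
  · rw [sum_smul_eq_lowerWeight_add hp]
    simp
  · rw [sum_smul_eq_lowerWeight_add hp, le_add_iff_nonneg_right]
    refine Finset.sum_nonneg fun V hV => ?_
    rw [Finset.mem_filter] at hV
    exact mul_nonneg (hw V hV.1).le
      (Finset.sum_nonneg fun i _ => (sum_eq_one_of_mem_coordSimplex (hp V hV.1)).1 i)

/-- Every nested family is the family of tight sets at some point, which may be chosen in the
weighted Minkowski sum of the simplices. -/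
lemma IsNestedFamily.exists_tightSets_eq (hB : IsBuildingSet B) (hw : ∀ V ∈ B, 0 < w V)
    (hN : IsNestedFamily B N) :
    ∃ p : Finset (Fin (n + 1)) → Fin (n + 1) → ℝ, (∀ V ∈ B, p V ∈ coordSimplex V) ∧
      tightSets B (lowerWeight B w) (∑ V ∈ B, w V • p V) = N := by
  have hne : ∀ V ∈ B, (freeElements N V).Nonempty := fun V hV => by
    obtain ⟨i, hi, h⟩ := hN.exists_mem_forall hB hV
    exact ⟨i, Finset.mem_filter.2 ⟨hi, h⟩⟩
  have hp : ∀ V ∈ B, freeBarycenter N V ∈ coordSimplex V := fun V hV =>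
    freeBarycenter_mem_coordSimplex (hne V hV)
  refine ⟨freeBarycenter N, hp, ?_⟩
  have hnn : ∀ V ∈ B, ∀ i, 0 ≤ freeBarycenter N V i := fun V hV =>
    (sum_eq_one_of_mem_coordSimplex (hp V hV)).1
  ext T
  rw [mem_tightSets, sum_smul_eq_lowerWeight_add hp, add_eq_left]
  constructor
  · rintro ⟨hT, h0⟩
    by_contra hTN
    obtain ⟨i, hiT, hi⟩ := hN.exists_mem_forall hB hT
    -- Take the smallest member `S` of `N` above `T`. The element `i` is free for `S` too, so the
    -- summand of `S` puts mass on `i ∈ T` and gives `T` positive slack.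
    obtain ⟨S, hS, hmin⟩ := Finset.exists_min_image (N.filter (T ⊆ ·)) Finset.card
      ⟨Finset.univ, by simp [hN.univ_mem]⟩
    simp only [Finset.mem_filter] at hS hmin
    have hST : ¬S ⊆ T := fun h => hTN (Finset.Subset.antisymm h hS.2 ▸ hS.1)
    have hiS : i ∈ freeElements N S := by
      refine Finset.mem_filter.2 ⟨hS.2 hiT, fun T' hT' hiT' => ?_⟩
      rcases hN.subset_or_subset hB hS.1 hT' ⟨i, Finset.mem_inter.2 ⟨hS.2 hiT, hiT'⟩⟩ with h | h
      · exact h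
      · exact (Finset.eq_of_subset_of_card_le h (hmin T' ⟨hT', hi T' hT' hiT'⟩)).ge
    have hSB := hN.subset hS.1
    refine absurd h0 (ne_of_gt (Finset.sum_pos' (fun V hV => ?_) ⟨S, ?_, ?_⟩))
    · rw [Finset.mem_filter] at hV
      exact mul_nonneg (hw V hV.1).le (Finset.sum_nonneg fun i _ => hnn V hV.1 i)
    · simp [hSB, hST]
    · refine mul_pos (hw S hSB) (Finset.sum_pos' (fun j _ => hnn S hSB j) ⟨i, hiT, ?_⟩)
      rw [freeBarycenter, if_pos hiS]
      exact inv_pos.2 (by exact_mod_cast (hne S hSB).card_pos)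
  · intro hT
    -- If `V` is not inside `T ∈ N`, no free element of `V` lies in `T`, so the slack of `T`
    -- vanishes term by term.
    refine ⟨hN.subset hT, Finset.sum_eq_zero fun V hV => ?_⟩
    rw [Finset.mem_filter] at hV
    rw [Finset.sum_eq_zero, mul_zero]
    intro i hi
    rw [freeBarycenter, if_neg]
    exact fun h => hV.2 ((Finset.mem_filter.1 h).2 T hT hi)

/-- The right-hand side does not mention `w`: all positive weights give the same face poset. -/
lemma tightSets_image_subsetSumPolytope (hB : IsConnectedBuildingSet B)
    (hw : ∀ V ∈ B, 0 < w V) :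
    tightSets B (lowerWeight B w) '' subsetSumPolytope B (lowerWeight B w) =
      {N | IsNestedFamily B N} := by
  ext N
  constructor
  · rintro ⟨x, hx, rfl⟩
    exact isNestedFamily_tightSets hB hw hx
  · intro hN
    obtain ⟨p, hp, h⟩ := hN.exists_tightSets_eq hB.1 hw
    exact ⟨_, sum_smul_mem_subsetSumPolytope hw hp, h⟩

lemma isCompact_coordSimplex (S : Finset (Fin (n + 1))) : IsCompact (coordSimplex S) :=
  (S.finite_toSet.image _).isCompact_convexHull ℝ

lemma convex_nestohedron : Convex ℝ (nestohedron B) := by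
  unfold nestohedron
  induction B using Finset.induction_on with
  | empty => exact convex_singleton (𝕜 := ℝ) (0 : Fin (n + 1) → ℝ)
  | insert S B hS ih =>
    rw [Finset.sum_insert hS]
    exact (convex_convexHull ℝ _).add ih

lemma isCompact_nestohedron : IsCompact (nestohedron B) := by
  unfold nestohedron
  induction B using Finset.induction_on with
  | empty => exact isCompact_singleton (x := (0 : Fin (n + 1) → ℝ))
  | insert S B hS ih =>
    rw [Finset.sum_insert hS]
    exact (isCompact_coordSimplex S).add ih

/-- The facet description of the nestohedron. -/
lemma nestohedron_eq_subsetSumPolytope (hB : IsConnectedBuildingSet B) :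
    nestohedron B = subsetSumPolytope B (lowerWeight B 1) := by
  have hw : ∀ V ∈ B, (0 : ℝ) < (1 : Finset (Fin (n + 1)) → ℝ) V := fun _ _ => one_pos
  apply Set.Subset.antisymm
  · intro x hx
    obtain ⟨p, hp, rfl⟩ := (Set.mem_finsetSum _ _ _).1 hx
    simpa using sum_smul_mem_subsetSumPolytope hw (p := p) (fun V hV => hp hV)
  · intro x hx
    by_contra hxM
    obtain ⟨l, u, hlu, hux⟩ := geometric_hahn_banach_closed_point convex_nestohedron
      isCompact_nestohedron.isClosed hxM
    obtain ⟨z, hz, hzmax⟩ := (isCompact_subsetSumPolytope hB.1.singleton_mem).exists_isMaxOn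
      ⟨x, hx⟩ l.continuous.continuousOn
    -- If `l` separates `x` from the Minkowski sum, consider the face where `l` is maximal on the
    -- larger polytope. Its tight family is also realised by a point of the Minkowski sum, which
    -- then lies on this face, so `l` is at least `l x` there.
    let F : Set (Fin (n + 1) → ℝ) := {z ∈ subsetSumPolytope B (lowerWeight B 1) |
      ∀ y ∈ subsetSumPolytope B (lowerWeight B 1), l y ≤ l z}
    obtain ⟨v, _, hv, hF⟩ := exists_eq_tightFace hB.2 (F := F) (fun _ => ⟨l, rfl⟩)
      ⟨z, hz, fun y hy => hzmax hy⟩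
    obtain ⟨p, hp, hpv⟩ := (isNestedFamily_tightSets hB hw hv).exists_tightSets_eq hB.1 hw
    have hmem : ∑ V ∈ B, (1 : Finset (Fin (n + 1)) → ℝ) V • p V ∈ F := by
      rw [hF]
      exact ⟨sum_smul_mem_subsetSumPolytope hw hp, hpv.ge⟩
    have h1 := hmem.2 x hx
    have h2 := hlu (∑ V ∈ B, (1 : Finset (Fin (n + 1)) → ℝ) V • p V)
      ((Set.mem_finsetSum _ _ _).2 ⟨p, fun hV => hp _ hV, by simp⟩)
    linarith

end WeightedNestohedra

/-! ### Facets, simplicity and the meaning of flagness -/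

section FacesOfNestohedra

variable {n : ℕ} {B N : Finset (Finset (Fin (n + 1)))} {w : Finset (Fin (n + 1)) → ℝ}

lemma isNestedFamily_singleton_univ (hB : IsConnectedBuildingSet B) :
    IsNestedFamily B {Finset.univ} := by
  refine ⟨by simpa using hB.2, by simp, fun A hA hsup => ?_⟩
  rcases Finset.subset_singleton_iff.1 hA with rfl | rfl
  · exact absurd (hB.1.nonempty_of_mem _ hsup) (by simp)
  · simp

lemma isNestedFamily_pair (hB : IsConnectedBuildingSet B) {S : Finset (Fin (n + 1))}
    (hS : S ∈ B) : IsNestedFamily B {Finset.univ, S} := by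
  refine ⟨by simp [Finset.insert_subset_iff, hB.2, hS], by simp, fun A hA hsup => ?_⟩
  by_cases hu : Finset.univ ∈ A
  · rwa [(Finset.le_sup (f := id) hu).antisymm' (Finset.subset_univ _)]
  · have hA' : A ⊆ {S} := fun T hT => by
      rcases Finset.mem_insert.1 (hA hT) with rfl | h
      · exact absurd hT hu
      · exact h
    rcases Finset.subset_singleton_iff.1 hA' with rfl | rfl
    · exact absurd (hB.1.nonempty_of_mem _ hsup) (by simp)
    · simp

lemma isNestedFamily_triple (hB : IsConnectedBuildingSet B) {I J : Finset (Fin (n + 1))}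
    (hI : I ∈ B) (hJ : J ∈ B) (hIJ : I ∪ J ∉ B) :
    IsNestedFamily B {Finset.univ, I, J} := by
  refine ⟨by simp [Finset.insert_subset_iff, hB.2, hI, hJ], by simp, fun A hA hsup => ?_⟩
  by_cases hu : Finset.univ ∈ A
  · rwa [(Finset.le_sup (f := id) hu).antisymm' (Finset.subset_univ _)]
  · have hA' : A ⊆ {I, J} := fun T hT => by
      rcases Finset.mem_insert.1 (hA hT) with rfl | h
      · exact absurd hT hu
      · exact h
    have hA'' : A = ∅ ∨ A = {I} ∨ A = {J} ∨ A = {I, J} := by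
      have h := Set.subset_pair_iff_eq.1 (by simpa using Finset.coe_subset.2 hA')
      simpa only [← Finset.coe_inj, Finset.coe_empty, Finset.coe_singleton, Finset.coe_pair] using h
    rcases hA'' with rfl | rfl | rfl | rfl
    · exact absurd (hB.1.nonempty_of_mem _ hsup) (by simp)
    · simp
    · simp
    · exact absurd (by simpa using hsup) hIJ

lemma IsNestedFamily.exists_mem_tightSets_eq (hB : IsConnectedBuildingSet B)
    (hw : ∀ V ∈ B, 0 < w V) (hN : IsNestedFamily B N) :
    ∃ x ∈ subsetSumPolytope B (lowerWeight B w), tightSets B (lowerWeight B w) x = N := by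
  have : N ∈ {N | IsNestedFamily B N} := hN
  rwa [← tightSets_image_subsetSumPolytope hB hw] at this

lemma polyDim_tightFace_add_card_of_nested (hB : IsConnectedBuildingSet B)
    (hw : ∀ V ∈ B, 0 < w V) (hN : IsNestedFamily B N) :
    polyDim (tightFace B (lowerWeight B w) N) + N.card = n + 1 := by
  obtain ⟨x, hx, rfl⟩ := hN.exists_mem_tightSets_eq hB hw
  exact polyDim_tightFace_add_card hB.1 hx hN

lemma tightFace_singleton_univ (hB : IsConnectedBuildingSet B) :
    tightFace B (lowerWeight B w) {Finset.univ} = subsetSumPolytope B (lowerWeight B w) :=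
  Set.Subset.antisymm tightFace_subset fun _ hx =>
    ⟨hx, Finset.singleton_subset_iff.2 (univ_mem_tightSets hB.2 hx)⟩

lemma polyDim_subsetSumPolytope (hB : IsConnectedBuildingSet B) (hw : ∀ V ∈ B, 0 < w V) :
    polyDim (subsetSumPolytope B (lowerWeight B w)) = n := by
  have h := polyDim_tightFace_add_card_of_nested hB hw (isNestedFamily_singleton_univ hB)
  rw [tightFace_singleton_univ hB] at h
  simpa using h

/-- The facets of a weighted nestohedron correspond to the proper members of the building set. -/
lemma isFacet_iff (hB : IsConnectedBuildingSet B) (hw : ∀ V ∈ B, 0 < w V)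
    {F : Set (Fin (n + 1) → ℝ)} :
    IsFacet (subsetSumPolytope B (lowerWeight B w)) F ↔
      ∃ S ∈ B, S ≠ Finset.univ ∧ F = tightFace B (lowerWeight B w) {Finset.univ, S} := by
  constructor
  · rintro ⟨hF, hne, hdim⟩
    obtain ⟨x, _, hx, rfl⟩ := exists_eq_tightFace hB.2 hF hne
    have hN := isNestedFamily_tightSets hB hw hx
    have h := polyDim_tightFace_add_card hB.1 hx hN
    rw [polyDim_subsetSumPolytope hB hw] at hdim
    have hcard : (tightSets B (lowerWeight B w) x).card = 2 := by omega
    obtain ⟨S, T, hST, hN'⟩ := Finset.card_eq_two.1 hcard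
    have hu := hN.univ_mem
    have hsub := hN.subset
    rw [hN'] at hu hsub ⊢
    rw [Finset.insert_subset_iff, Finset.singleton_subset_iff] at hsub
    rcases Finset.mem_insert.1 hu with rfl | h
    · exact ⟨T, hsub.2, hST.symm, rfl⟩
    · obtain rfl := Finset.mem_singleton.1 h
      exact ⟨S, hsub.1, hST, by rw [Finset.pair_comm]⟩
  · rintro ⟨S, hS, hSu, rfl⟩
    have hN := isNestedFamily_pair hB hS
    have h := polyDim_tightFace_add_card_of_nested hB hw hN
    rw [Finset.card_pair hSu.symm] at h
    obtain ⟨x, hx, hxN⟩ := hN.exists_mem_tightSets_eq hB hw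
    rw [← hxN] at h ⊢
    refine ⟨isExposed_tightFace hx, ⟨x, mem_tightFace_self hx⟩, ?_⟩
    rw [polyDim_subsetSumPolytope hB hw]
    omega

lemma mem_tightFace_pair (hB : IsConnectedBuildingSet B) {S : Finset (Fin (n + 1))}
    {x : Fin (n + 1) → ℝ} (hx : x ∈ subsetSumPolytope B (lowerWeight B w)) :
    x ∈ tightFace B (lowerWeight B w) {Finset.univ, S} ↔
      S ∈ tightSets B (lowerWeight B w) x := by
  simp [tightFace, hx, Finset.insert_subset_iff, univ_mem_tightSets hB.2 hx]

/-- At a vertex the tight face is a point, so there are n + 1 tight sets; all but the ground set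
give distinct facets. -/
lemma isSimplePolytope_subsetSumPolytope (hB : IsConnectedBuildingSet B)
    (hw : ∀ V ∈ B, 0 < w V) : IsSimplePolytope (subsetSumPolytope B (lowerWeight B w)) := by
  obtain ⟨x₀, hx₀, _⟩ := (isNestedFamily_singleton_univ hB).exists_mem_tightSets_eq hB hw
  refine ⟨isPolytope_subsetSumPolytope hB.2 hB.1.singleton_mem ⟨x₀, hx₀⟩, fun v hv => ?_⟩
  have hN := isNestedFamily_tightSets hB hw hv.1
  have hdim := polyDim_tightFace_add_card hB.1 hv.1 hN
  have hpt : tightFace B (lowerWeight B w) (tightSets B (lowerWeight B w) v) = {v} :=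
    Set.Subset.antisymm (fun y hy => eq_of_mem_tightFace_of_extreme hB.2 hv hy)
      (by simpa using mem_tightFace_self hv.1)
  have h0 : polyDim ({v} : Set (Fin (n + 1) → ℝ)) = 0 := by
    simp [polyDim]
  rw [hpt, h0, zero_add] at hdim
  have himg : {F | IsFacet (subsetSumPolytope B (lowerWeight B w)) F ∧ v ∈ F} =
      (fun S => tightFace B (lowerWeight B w) {Finset.univ, S}) ''
        ((tightSets B (lowerWeight B w) v).erase Finset.univ : Finset _) := by
    ext F
    simp only [Set.mem_ofPred_eq, isFacet_iff hB hw, Set.mem_image, Finset.mem_coe,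
      Finset.mem_erase]
    constructor
    · rintro ⟨⟨S, hS, hSu, rfl⟩, hvS⟩
      exact ⟨S, ⟨hSu, (mem_tightFace_pair hB hv.1).1 hvS⟩, rfl⟩
    · rintro ⟨S, ⟨hSu, hvS⟩, rfl⟩
      exact ⟨⟨S, hN.subset hvS, hSu, rfl⟩, (mem_tightFace_pair hB hv.1).2 hvS⟩
  rw [himg, Set.InjOn.encard_image, Set.encard_coe_eq_coe_finsetCard,
    Finset.card_erase_of_mem hN.univ_mem, hdim, polyDim_subsetSumPolytope hB hw,
    Nat.add_sub_cancel]
  intro S hS T hT hST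
  simp only [Finset.coe_erase, Set.mem_sdiff, Finset.mem_coe, Set.mem_singleton_iff] at hS hT
  obtain ⟨x, hx, hxN⟩ :=
    (isNestedFamily_pair hB (hN.subset hS.1)).exists_mem_tightSets_eq hB hw
  have h1 : x ∈ tightFace B (lowerWeight B w) {Finset.univ, T} := by
    rw [← show _ = tightFace B (lowerWeight B w) {Finset.univ, T} from hST,
      mem_tightFace_pair hB hx, hxN]
    simp
  rw [mem_tightFace_pair hB hx, hxN] at h1
  simpa [hT.2, eq_comm] using h1

/-- In the building set of a flag nestohedron every member with more than one element is
the disjoint union of two members. -/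
lemma exists_disjoint_union_of_isFlagPolytope (hB : IsConnectedBuildingSet B)
    (hflag : IsFlagPolytope (nestohedron B)) {S : Finset (Fin (n + 1))} (hS : S ∈ B)
    (hcard : 1 < S.card) (hSu : S ≠ Finset.univ) : ∃ I ∈ B, ∃ J ∈ B, Disjoint I J ∧ I ∪ J = S := by
  classical
  have hw : ∀ V ∈ B, (0 : ℝ) < (1 : Finset (Fin (n + 1)) → ℝ) V := fun _ _ => one_pos
  rw [nestohedron_eq_subsetSumPolytope hB] at hflag
  -- Partitions of `S` into members of `B` other than `S`, the singletons being one. In a partition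
  -- with fewest parts, two parts whose union is in `B` must fill up `S`, as merging them would
  -- otherwise give a smaller partition.
  let P : Finset (Finset (Fin (n + 1))) → Prop := fun A =>
    A ⊆ B ∧ (A : Set (Finset (Fin (n + 1)))).PairwiseDisjoint id ∧ A.sup id = S ∧ S ∉ A
  have hex : P (S.image fun i => {i}) := by
    refine ⟨?_, ?_, ?_, ?_⟩
    · intro T hT
      obtain ⟨i, _, rfl⟩ := Finset.mem_image.1 hT
      exact hB.1.singleton_mem i
    · intro T hT T' hT' hne
      obtain ⟨i, _, rfl⟩ := Finset.mem_image.1 (Finset.mem_coe.1 hT)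
      obtain ⟨j, _, rfl⟩ := Finset.mem_image.1 (Finset.mem_coe.1 hT')
      simpa [Function.onFun] using hne
    · rw [Finset.sup_image]
      exact Finset.sup_singleton_eq_self S
    · intro h
      obtain ⟨i, _, rfl⟩ := Finset.mem_image.1 h
      simp at hcard
  obtain ⟨A, ⟨hAB, hdisj, hsup, hSA⟩, hmin⟩ := (measure Finset.card).wf.has_min {A | P A} ⟨_, hex⟩
  have hproper : ∀ X ∈ A, X ≠ Finset.univ := by
    rintro X hX rfl
    exact hSu (Finset.univ_subset_iff.1 (hsup ▸ Finset.le_sup (f := id) hX))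
  by_cases hpair : ∃ X ∈ A, ∃ Y ∈ A, X ≠ Y ∧ X ∪ Y ∈ B
  · obtain ⟨X, hX, Y, hY, hXY, hXYB⟩ := hpair
    refine ⟨X, hAB hX, Y, hAB hY, hdisj hX hY hXY, ?_⟩
    by_contra hne
    refine hmin (insert (X ∪ Y) ((A.erase X).erase Y)) ⟨?_, ?_, ?_, ?_⟩ ?_
    · exact Finset.insert_subset hXYB
        (((Finset.erase_subset _ _).trans (Finset.erase_subset _ _)).trans hAB)
    · rw [Finset.coe_insert, Set.pairwiseDisjoint_insert]
      refine ⟨hdisj.subset (by simp [Set.subset_def]; tauto), ?_⟩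
      intro Z hZ _
      simp only [Finset.coe_erase, Set.mem_sdiff, Finset.mem_coe, Set.mem_singleton_iff] at hZ
      exact Finset.disjoint_union_left.2
        ⟨hdisj hX hZ.1.1 (Ne.symm hZ.1.2), hdisj hY hZ.1.1 (Ne.symm hZ.2)⟩
    · rw [← hsup, Finset.sup_insert, ← Finset.insert_erase hX,
        ← Finset.insert_erase (Finset.mem_erase.2 ⟨hXY.symm, hY⟩), Finset.sup_insert,
        Finset.sup_insert]
      simp [hXY, Finset.union_assoc]
    · intro h
      rcases Finset.mem_insert.1 h with h | h
      · exact hne h.symm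
      · exact hSA (Finset.mem_of_mem_erase (Finset.mem_of_mem_erase h))
    · show (insert (X ∪ Y) ((A.erase X).erase Y)).card < A.card
      have h1 := Finset.card_insert_le (X ∪ Y) ((A.erase X).erase Y)
      have h2 := Finset.card_erase_add_one (Finset.mem_erase.2 ⟨hXY.symm, hY⟩)
      have h3 := Finset.card_erase_add_one hX
      omega
  · push Not at hpair
    exfalso
    -- If no two parts have union in `B`, their facets meet pairwise, hence by flagness at one point
    -- `z`. All parts are tight at `z` and their union `S` is in `B`, so nestedness makes `S` a
    -- part.
    obtain ⟨z, hz, hzF⟩ := hflag.2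
      ((fun S => tightFace B (lowerWeight B 1) {Finset.univ, S}) '' (A : Set _)) (by
        rintro _ ⟨X, hX, rfl⟩
        exact (isFacet_iff hB hw).2 ⟨X, hAB hX, hproper X hX, rfl⟩) (by
        rintro _ ⟨X, hX, rfl⟩ _ ⟨Y, hY, rfl⟩
        by_cases hXY : X = Y
        · subst hXY
          obtain ⟨x, hx, hxN⟩ := (isNestedFamily_pair hB (hAB hX)).exists_mem_tightSets_eq hB hw
          refine ⟨x, ?_, ?_⟩ <;> simp [mem_tightFace_pair hB hx, hxN]
        · obtain ⟨x, hx, hxN⟩ := (isNestedFamily_triple hB (hAB hX) (hAB hY)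
            (hpair X hX Y hY hXY)).exists_mem_tightSets_eq hB hw
          refine ⟨x, ?_, ?_⟩ <;> simp [mem_tightFace_pair hB hx, hxN])
    refine hSA (hsup ▸ (isNestedFamily_tightSets hB hw hz).sup_mem A (fun X hX => ?_)
      (hsup ▸ hS))
    exact (mem_tightFace_pair hB hz).1 (hzF _ ⟨X, hX, rfl⟩)

end FacesOfNestohedra

/-! ### Adjoining a disjoint union as a codimension-two shaving -/

section Shaving

variable {n : ℕ} {B : Finset (Finset (Fin (n + 1)))} {w : Finset (Fin (n + 1)) → ℝ}

/-- Weights whose partial sums over the members of `B` are `1` at `T` and `0` elsewhere. -/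
lemma exists_sum_subset_eq_ite (B : Finset (Finset (Fin (n + 1))))
    (T : Finset (Fin (n + 1))) (hT : T ∈ B) :
    ∃ δ : Finset (Fin (n + 1)) → ℝ, (∀ U ∈ B, lowerWeight B δ U = if U = T then 1 else 0) ∧
      δ T = 1 := by
  have hex : ∀ k, ∃ δ : Finset (Fin (n + 1)) → ℝ,
      ∀ U ∈ B, U.card < k → lowerWeight B δ U = if U = T then 1 else 0 := by
    intro k
    induction k with
    | zero => exact ⟨0, by simp⟩
    | succ k ih =>
      obtain ⟨δ, hδ⟩ := ih
      -- Möbius inversion: the weight of a set of cardinality `k` corrects the total already fixed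
      -- by its proper subsets in `B`.
      refine ⟨fun U => if U.card = k then
        (if U = T then 1 else 0) - ∑ V ∈ B with V ⊂ U, δ V else δ U, fun U hU hUk => ?_⟩
      rcases (Nat.lt_succ_iff.1 hUk).lt_or_eq with h | h
      · rw [← hδ U hU h]
        refine Finset.sum_congr rfl fun V hV => if_neg ?_
        exact ((Finset.card_le_card (Finset.mem_filter.1 hV).2).trans_lt h).ne
      · have hsplit : (B.filter (· ⊆ U)) = insert U (B.filter (· ⊂ U)) := by
          ext V
          simp only [Finset.mem_filter, Finset.mem_insert, Finset.ssubset_iff_subset_ne]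
          by_cases hVU : V = U
          · simp [hVU, hU]
          · simp [hVU]
        rw [lowerWeight, hsplit, Finset.sum_insert (by simp), if_pos h,
          Finset.sum_congr rfl fun V hV => if_neg
            ((Finset.card_lt_card (Finset.mem_filter.1 hV).2).trans_eq h).ne]
        ring
  obtain ⟨δ, hδ⟩ := hex (n + 2)
  have hδ' : ∀ U ∈ B, lowerWeight B δ U = if U = T then 1 else 0 := fun U hU =>
    hδ U hU ((Finset.card_le_univ U).trans_lt (by simp))
  refine ⟨δ, hδ', ?_⟩
  have hzero : ∀ U, U ∈ B → U ⊂ T → δ U = 0 := by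
    intro U
    induction U using Finset.strongInduction with
    | H U ih =>
      intro hU hUT
      have h := hδ' U hU
      rw [if_neg hUT.ne, lowerWeight, Finset.sum_eq_single U] at h
      · exact h
      · intro V hV hVU
        rw [Finset.mem_filter] at hV
        have := hV.2.ssubset_of_ne hVU
        exact ih V this hV.1 (this.trans hUT)
      · simp [hU]
  have h := hδ' T hT
  rw [if_pos rfl, lowerWeight, Finset.sum_eq_single T] at h
  · exact h
  · intro V hV hVT
    rw [Finset.mem_filter] at hV
    exact hzero V hV.1 (hV.2.ssubset_of_ne hVT)
  · simp [hT]

/-- Adjoining to a building set one set that splits into two of its members shaves a face of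
codimension two. -/
lemma exists_isCodimTwoShaving (hB : IsConnectedBuildingSet B) (hw : ∀ V ∈ B, 0 < w V)
    {I J : Finset (Fin (n + 1))} (hI : I ∈ B) (hJ : J ∈ B) (hd : Disjoint I J)
    (hT : I ∪ J ∉ B) :
    ∃ w' : Finset (Fin (n + 1)) → ℝ, (∀ V ∈ insert (I ∪ J) B, 0 < w' V) ∧
      IsCodimTwoShaving (subsetSumPolytope B (lowerWeight B w))
        (subsetSumPolytope (insert (I ∪ J) B) (lowerWeight (insert (I ∪ J) B) w')) := by
  classical
  set T := I ∪ J with hTdef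
  set B' := insert T B with hB'
  set g := lowerWeight B w with hg
  have hIne := hB.1.nonempty_of_mem I hI
  have hJne := hB.1.nonempty_of_mem J hJ
  have hIJ : I ≠ J := fun h => hIne.ne_empty (disjoint_self.1 (h ▸ hd))
  have hIu : I ≠ Finset.univ := fun h => by
    obtain ⟨j, hj⟩ := hJne
    exact Finset.disjoint_right.1 hd hj (h ▸ Finset.mem_univ j)
  have hJu : J ≠ Finset.univ := fun h => by
    obtain ⟨j, hj⟩ := hIne
    exact Finset.disjoint_left.1 hd hj (h ▸ Finset.mem_univ j)
  -- A member `V` inside `T` that met both `I` and `J` would give I ∪ V ∪ J = T ∈ B.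
  have hgT : g T = g I + g J := by
    rw [hg, lowerWeight, lowerWeight, lowerWeight, ← Finset.sum_union]
    · congr 1
      ext V
      simp only [Finset.mem_filter, Finset.mem_union]
      refine ⟨fun ⟨hV, hVT⟩ => ?_, ?_⟩
      · by_contra! hcon
        have h1 : (I ∩ V).Nonempty := by
          by_contra h
          refine hcon.2 hV (Disjoint.left_le_of_le_sup_left (hVT) ?_)
          rwa [disjoint_comm, Finset.disjoint_iff_inter_eq_empty, ← Finset.not_nonempty_iff_eq_empty]
        have h2 : (J ∩ V).Nonempty := by
          by_contra h
          refine hcon.1 hV (Disjoint.left_le_of_le_sup_right (hVT) ?_)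
          rwa [disjoint_comm, Finset.disjoint_iff_inter_eq_empty, ← Finset.not_nonempty_iff_eq_empty]
        have h3 := hB.1.union_mem _ (hB.1.union_mem I hI V hV h1) J hJ (by
          obtain ⟨i, hi⟩ := h2
          simp only [Finset.mem_inter] at hi
          exact ⟨i, by simp [hi.1, hi.2]⟩)
        apply hT
        convert h3 using 1
        rw [Finset.union_right_comm, Finset.union_eq_left.2 hVT]
      · rintro (⟨hV, h⟩ | ⟨hV, h⟩)
        · exact ⟨hV, h.trans Finset.subset_union_left⟩
        · exact ⟨hV, h.trans Finset.subset_union_right⟩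
    · rw [Finset.disjoint_left]
      intro V h1 h2
      simp only [Finset.mem_filter] at h1 h2
      obtain ⟨j, hj⟩ := hB.1.nonempty_of_mem V h1.1
      exact Finset.disjoint_left.1 hd (h1.2 hj) (h2.2 hj)
  have hxT : ∀ x : Fin (n + 1) → ℝ, ∑ i ∈ T, x i = ∑ i ∈ I, x i + ∑ i ∈ J, x i :=
    fun x => Finset.sum_union hd
  have hle : ∀ x ∈ subsetSumPolytope B g, g T ≤ ∑ i ∈ T, x i := fun x hx =>
    lowerWeight_le_sum hB.1 hx.2 T
  have hN := isNestedFamily_triple hB hI hJ hT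
  let l : StrongDual ℝ (Fin (n + 1) → ℝ) := -∑ i ∈ T, ContinuousLinearMap.proj i
  have hl : ∀ x, l x = -∑ i ∈ T, x i := by
    intro x; simp [l]
  have hG : tightFace B g {Finset.univ, I, J} = {x ∈ subsetSumPolytope B g | l x = -g T} := by
    ext x
    simp only [tightFace, Set.mem_ofPred_eq, and_congr_right_iff, hl, neg_inj, hxT, hgT,
      Finset.insert_subset_iff, Finset.singleton_subset_iff]
    intro hx
    simp only [univ_mem_tightSets hB.2 hx, mem_tightSets, hI, hJ, true_and]
    have h1 := hx.2 I hI
    have h2 := hx.2 J hJ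
    exact ⟨fun h => by rw [h.1, h.2], fun h => ⟨by linarith, by linarith⟩⟩
  obtain ⟨δ, hδ, hδT⟩ := exists_sum_subset_eq_ite B' T (Finset.mem_insert_self _ _)
  -- Small `ε` keeps the corrected weights positive and cuts off no vertex outside the face.
  have hev : ∀ᶠ ε : ℝ in nhdsWithin 0 (Set.Ioi 0), (∀ V ∈ B, 0 < w V + ε * δ V) ∧
      ∀ v ∈ (subsetSumPolytope B g).extremePoints ℝ, v ∉ tightFace B g {Finset.univ, I, J} →
        g T + ε < ∑ i ∈ T, v i := by
    refine Filter.Eventually.and ((Filter.eventually_all_finset B).2 fun V hV => ?_)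
      ((Filter.eventually_all_finite (finite_extremePoints_subsetSumPolytope hB.2)).2
        fun v hv => ?_)
    · have hc : Filter.Tendsto (fun ε : ℝ => w V + ε * δ V)
          (nhdsWithin 0 (Set.Ioi 0)) (nhds (w V + 0 * δ V)) :=
        (Continuous.tendsto (by fun_prop) 0).mono_left nhdsWithin_le_nhds
      rw [zero_mul, add_zero] at hc
      exact hc.eventually (lt_mem_nhds (hw V hV))
    · by_cases hvG : v ∈ tightFace B g {Finset.univ, I, J}
      · simp [hvG]
      · have hlt : g T < ∑ i ∈ T, v i := lt_of_le_of_ne (hle v hv.1) fun h => hvG (by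
          rw [hG]
          exact ⟨hv.1, by rw [hl, h]⟩)
        have hc : Filter.Tendsto (fun ε : ℝ => g T + ε)
            (nhdsWithin 0 (Set.Ioi 0)) (nhds (g T + 0)) :=
          (Continuous.tendsto (by fun_prop) 0).mono_left nhdsWithin_le_nhds
        rw [add_zero] at hc
        exact (hc.eventually (gt_mem_nhds hlt)).mono fun _ h _ => h
  obtain ⟨ε, ⟨hεw, hεv⟩, hε⟩ := (hev.and self_mem_nhdsWithin).exists
  replace hε : 0 < ε := hε
  -- By the choice of `δ`, these weights raise the bound of `T` by `ε` and leave the bounds of the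
  -- members of `B` unchanged; `T` itself has weight `ε`.
  let w' : Finset (Fin (n + 1)) → ℝ := fun V => (if V = T then 0 else w V) + ε * δ V
  have hg' : ∀ U ∈ B', lowerWeight B' w' U = g U + if U = T then ε else 0 := by
    intro U hU
    have h1 : lowerWeight B' w' U =
        lowerWeight B' (fun V => if V = T then 0 else w V) U + ε * lowerWeight B' δ U := by
      simp only [lowerWeight, w', Finset.sum_add_distrib, Finset.mul_sum]
    have h2 : lowerWeight B' (fun V => if V = T then 0 else w V) U = g U := by
      simp only [lowerWeight, hg, Finset.sum_filter, hB', Finset.sum_insert hT, if_true, ite_self,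
        zero_add]
      refine Finset.sum_congr rfl fun V hV => ?_
      rw [if_neg (fun h : V = T => hT (h ▸ hV))]
    rw [h1, h2, hδ U hU]
    simp
  have huT : Finset.univ ≠ T := fun h => hT (h ▸ hB.2)
  refine ⟨w', fun V hV => ?_, tightFace B g {Finset.univ, I, J}, ?_,
    isSimplePolytope_subsetSumPolytope hB hw, ?_, l, -g T, ε, hε, fun x hx => ?_, hG,
    fun v hv hvG => ?_, ?_⟩
  · rcases Finset.mem_insert.1 hV with rfl | hV
    · simp [w', hδT, hε]
    · have hVT : V ≠ T := fun h => hT (h ▸ hV)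
      simpa [w', hVT] using hεw V hV
  · have h1 := polyDim_tightFace_add_card_of_nested hB hw hN
    have h2 : ({Finset.univ, I, J} : Finset (Finset (Fin (n + 1)))).card = 3 :=
      Finset.card_eq_three.2 ⟨_, _, _, hIu.symm, hJu.symm, hIJ, rfl⟩
    rw [← hg, h2] at h1
    rw [polyDim_subsetSumPolytope hB hw]
    omega
  · obtain ⟨x, hx, hxN⟩ := hN.exists_mem_tightSets_eq hB hw
    exact ⟨x, hxN ▸ mem_tightFace_self hx⟩
  · rw [hl]
    linarith [hle x hx]
  · rw [hl]
    linarith [hεv v hv hvG]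
  · ext x
    simp only [subsetSumPolytope, Set.mem_ofPred_eq, hl]
    rw [hg' _ (Finset.mem_insert_of_mem hB.2), if_neg huT, add_zero, hB',
      Finset.forall_mem_insert, ← hB', hg' T (Finset.mem_insert_self _ _), if_pos rfl, and_assoc]
    have h1 : (∀ S ∈ B, lowerWeight B' w' S ≤ ∑ i ∈ S, x i) ↔ ∀ S ∈ B, g S ≤ ∑ i ∈ S, x i := by
      refine forall₂_congr fun S hS => ?_
      rw [hg' S (Finset.mem_insert_of_mem hS), if_neg (fun h : S = T => hT (h ▸ hS)), add_zero]
    rw [h1]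
    constructor
    · rintro ⟨h1, h2, h3⟩
      exact ⟨h1, h3, by linarith⟩
    · rintro ⟨h1, h2, h3⟩
      exact ⟨h1, by linarith, h2⟩

/-- Successive shavings along a growing chain of building sets. -/
lemma exists_reflTransGen_isCodimTwoShaving {B' : Finset (Finset (Fin (n + 1)))}
    (hB : IsConnectedBuildingSet B) (hw : ∀ V ∈ B, 0 < w V) (hB' : IsBuildingSet B') (hsub : B ⊆ B')
    (hsplit : ∀ T ∈ B', T ∉ B → ∃ I ∈ B, ∃ J ∈ B, Disjoint I J ∧ I ∪ J = T) :
    ∃ w' : Finset (Fin (n + 1)) → ℝ, (∀ V ∈ B', 0 < w' V) ∧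
      Relation.ReflTransGen IsCodimTwoShaving (subsetSumPolytope B (lowerWeight B w))
        (subsetSumPolytope B' (lowerWeight B' w')) := by
  induction hk : (B' \ B).card generalizing B w with
  | zero =>
    have : B = B' := Finset.Subset.antisymm hsub
      (Finset.sdiff_eq_empty_iff_subset.1 (Finset.card_eq_zero.1 hk))
    subst this
    exact ⟨w, hw, .refl⟩
  | succ k ih =>
    -- Adjoining a largest missing set keeps a building set: its union with a member that it meets
    -- is in `B'`, so it is in `B` already or equals `T`.
    obtain ⟨T, hT, hmax⟩ := Finset.exists_max_image (B' \ B) Finset.card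
      (Finset.card_pos.1 (by omega))
    rw [Finset.mem_sdiff] at hT
    obtain ⟨I, hI, J, hJ, hd, rfl⟩ := hsplit T hT.1 hT.2
    obtain ⟨w₁, hw₁, hshave⟩ := exists_isCodimTwoShaving hB hw hI hJ hd hT.2
    have hun : ∀ S ∈ B, (S ∩ (I ∪ J)).Nonempty → S ∪ (I ∪ J) ∈ insert (I ∪ J) B := by
      intro S hS h
      by_cases hmem : S ∪ (I ∪ J) ∈ B
      · exact Finset.mem_insert_of_mem hmem
      · have h1 := hmax _ (Finset.mem_sdiff.2 ⟨hB'.union_mem S (hsub hS) _ hT.1 h, hmem⟩)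
        rw [← Finset.eq_of_subset_of_card_le Finset.subset_union_right h1]
        exact Finset.mem_insert_self _ _
    have hB₁ : IsConnectedBuildingSet (insert (I ∪ J) B) := by
      refine ⟨⟨fun S hS => ?_, fun i => Finset.mem_insert_of_mem (hB.1.singleton_mem i),
        fun S hS S' hS' h => ?_⟩, Finset.mem_insert_of_mem hB.2⟩
      · rcases Finset.mem_insert.1 hS with rfl | hS
        · exact hB'.nonempty_of_mem _ hT.1
        · exact hB.1.nonempty_of_mem S hS
      · rcases Finset.mem_insert.1 hS with rfl | hS <;>
          rcases Finset.mem_insert.1 hS' with rfl | hS'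
        · simp
        · rw [Finset.union_comm (I ∪ J)]
          exact hun S' hS' (by rwa [Finset.inter_comm])
        · exact hun S hS h
        · exact Finset.mem_insert_of_mem (hB.1.union_mem S hS S' hS' h)
    obtain ⟨w₂, hw₂, hchain⟩ := ih hB₁ hw₁ (Finset.insert_subset hT.1 hsub)
      (fun T hT hTB => by
        rw [Finset.mem_insert, not_or] at hTB
        obtain ⟨I', hI', J', hJ', h⟩ := hsplit T hT hTB.2
        exact ⟨I', Finset.mem_insert_of_mem hI', J', Finset.mem_insert_of_mem hJ', h⟩)
      (by
        rw [Finset.sdiff_insert, Finset.card_erase_of_mem (Finset.mem_sdiff.2 hT), hk]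
        rfl)
    exact ⟨w₂, hw₂, .head hshave hchain⟩

lemma obtainedByCodimTwoShavings_of_split {B' : Finset (Finset (Fin (n + 1)))}
    (hB : IsConnectedBuildingSet B) (hB' : IsBuildingSet B') (hsub : B ⊆ B')
    (hsplit : ∀ T ∈ B', T ∉ B → ∃ I ∈ B, ∃ J ∈ B, Disjoint I J ∧ I ∪ J = T) :
    ObtainedByCodimTwoShavings (nestohedron B) (nestohedron B') := by
  have hc : IsConnectedBuildingSet B' := ⟨hB', hsub hB.2⟩
  obtain ⟨w, hw, h⟩ := exists_reflTransGen_isCodimTwoShaving (w := 1) hB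
    (fun _ _ => one_pos) hB' hsub hsplit
  rw [nestohedron_eq_subsetSumPolytope hB, nestohedron_eq_subsetSumPolytope hc]
  refine ⟨_, h, combinatoriallyEquivalent_of_tightSets hc.2 ?_⟩
  rw [tightSets_image_subsetSumPolytope hc hw,
    tightSets_image_subsetSumPolytope hc (w := 1) fun _ _ => one_pos]

/-- The closure of a building set together with the union of two of its members. -/
lemma exists_isBuildingClosure_insert (hB : IsBuildingSet B) {I J : Finset (Fin (n + 1))}
    (hI : I ∈ B) (hJ : J ∈ B) :
    ∃ C, IsBuildingClosure (insert (I ∪ J) B) C ∧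
      ∀ T ∈ C, T ∉ B → ∃ X ∈ B, ∃ Y ∈ B, Disjoint X Y ∧ X ∪ Y = T := by
  classical
  -- The unions X ∪ Y with I ⊆ X and J ⊆ Y are closed under gluing: a member of `B` is absorbed by
  -- the part that it meets, and two such unions merge part by part.
  let C : Finset (Finset (Fin (n + 1))) := Finset.univ.filter fun T =>
    T ∈ B ∨ ∃ X ∈ B, ∃ Y ∈ B, I ⊆ X ∧ J ⊆ Y ∧ X ∪ Y = T
  have hC : ∀ T, T ∈ C ↔ T ∈ B ∨ ∃ X ∈ B, ∃ Y ∈ B, I ⊆ X ∧ J ⊆ Y ∧ X ∪ Y = T := by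
    simp [C]
  obtain ⟨i, hi⟩ := hB.nonempty_of_mem I hI
  obtain ⟨j, hj⟩ := hB.nonempty_of_mem J hJ
  have hmix : ∀ X ∈ B, ∀ Y ∈ B, I ⊆ X → J ⊆ Y → ∀ T ∈ B, ((X ∪ Y) ∩ T).Nonempty →
      X ∪ Y ∪ T ∈ C := by
    rintro X hX Y hY hIX hJY T hT ⟨k, hk⟩
    rw [Finset.mem_inter, Finset.mem_union] at hk
    refine (hC _).2 (Or.inr ?_)
    rcases hk with ⟨hk | hk, hkT⟩
    · exact ⟨X ∪ T, hB.union_mem X hX T hT ⟨k, Finset.mem_inter.2 ⟨hk, hkT⟩⟩, Y, hY,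
        hIX.trans Finset.subset_union_left, hJY, Finset.union_right_comm _ _ _⟩
    · exact ⟨X, hX, Y ∪ T, hB.union_mem Y hY T hT ⟨k, Finset.mem_inter.2 ⟨hk, hkT⟩⟩,
        hIX, hJY.trans Finset.subset_union_left, (Finset.union_assoc _ _ _).symm⟩
  have hCb : IsBuildingSet C := by
    refine ⟨fun S hS => ?_, fun i => (hC _).2 (Or.inl (hB.singleton_mem i)),
      fun S hS T hT hST => ?_⟩
    · rcases (hC S).1 hS with h | ⟨X, hX, Y, hY, _, _, rfl⟩
      · exact hB.nonempty_of_mem S h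
      · exact (hB.nonempty_of_mem X hX).mono Finset.subset_union_left
    · rcases (hC S).1 hS with hSB | ⟨X, hX, Y, hY, hIX, hJY, rfl⟩ <;>
        rcases (hC T).1 hT with hTB | ⟨X', hX', Y', hY', hIX', hJY', rfl⟩
      · exact (hC _).2 (Or.inl (hB.union_mem S hSB T hTB hST))
      · rw [Finset.union_comm]
        exact hmix X' hX' Y' hY' hIX' hJY' S hSB (by rwa [Finset.inter_comm])
      · exact hmix X hX Y hY hIX hJY T hTB hST
      · exact (hC _).2 (Or.inr ⟨X ∪ X', hB.union_mem X hX X' hX'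
          ⟨i, Finset.mem_inter.2 ⟨hIX hi, hIX' hi⟩⟩, Y ∪ Y', hB.union_mem Y hY Y' hY'
          ⟨j, Finset.mem_inter.2 ⟨hJY hj, hJY' hj⟩⟩, hIX.trans Finset.subset_union_left,
          hJY.trans Finset.subset_union_left, Finset.union_union_union_comm _ _ _ _⟩)
  refine ⟨C, ⟨⟨hCb, Finset.insert_subset ?_ fun T hT => (hC T).2 (Or.inl hT)⟩, ?_⟩, ?_⟩
  · exact (hC _).2 (Or.inr ⟨I, hI, J, hJ, subset_rfl, subset_rfl, rfl⟩)
  · rintro D ⟨hD, hsub⟩ T hT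
    rcases (hC T).1 hT with h | ⟨X, hX, Y, hY, hIX, hJY, rfl⟩
    · exact hsub (Finset.mem_insert_of_mem h)
    · have h1 := hD.union_mem X (hsub (Finset.mem_insert_of_mem hX)) (I ∪ J)
        (hsub (Finset.mem_insert_self _ _)) ⟨i, by simp [hIX hi, hi]⟩
      have h2 := hD.union_mem _ h1 Y (hsub (Finset.mem_insert_of_mem hY))
        ⟨j, by simp [hJY hj, hj]⟩
      convert h2 using 1
      ext k
      simp only [Finset.mem_union]
      exact ⟨by tauto, by rintro ((h | h | h) | h) <;> simp [h, hIX _, hJY _]⟩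
  · intro T hT hTB
    rcases (hC T).1 hT with h | ⟨X, hX, Y, hY, _, _, rfl⟩
    · exact absurd h hTB
    · refine ⟨X, hX, Y, hY, ?_, rfl⟩
      by_contra h
      exact hTB (hB.union_mem X hX Y hY (Finset.not_disjoint_iff_nonempty_inter.1 h))

end Shaving

theorem mainTheorem6 (n : ℕ) (B₁ B₃ : Finset (Finset (Fin (n + 1))))
    (hB₁ : IsConnectedBuildingSet B₁) (hB₃ : IsConnectedBuildingSet B₃) (hlt : B₁ ⊂ B₃)
    (hflag₁ : IsFlagPolytope (nestohedron B₁)) (hflag₃ : IsFlagPolytope (nestohedron B₃)) :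
    (∃ B₂ : Finset (Finset (Fin (n + 1))),
      IsConnectedBuildingSet B₂ ∧ B₁ ⊂ B₂ ∧ B₂ ⊆ B₃ ∧
        ObtainedByCodimTwoShavings (nestohedron B₁) (nestohedron B₂)) ∧
    (∀ S : Finset (Fin (n + 1)), Minimal (fun T => T ∈ B₃ \ B₁) S →
      ∃ B₂ : Finset (Finset (Fin (n + 1))),
        IsBuildingClosure (insert S B₁) B₂ ∧ B₁ ⊂ B₂ ∧ B₂ ⊆ B₃ ∧
          ObtainedByCodimTwoShavings (nestohedron B₁) (nestohedron B₂)) := by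
  have main : ∀ S : Finset (Fin (n + 1)), Minimal (fun T => T ∈ B₃ \ B₁) S →
      ∃ B₂ : Finset (Finset (Fin (n + 1))),
        IsBuildingClosure (insert S B₁) B₂ ∧ B₁ ⊂ B₂ ∧ B₂ ⊆ B₃ ∧
          ObtainedByCodimTwoShavings (nestohedron B₁) (nestohedron B₂) := by
    intro S hS
    obtain ⟨hS₃, hS₁⟩ := Finset.mem_sdiff.1 hS.prop
    have hSne := hB₃.1.nonempty_of_mem S hS₃
    have hcard : 1 < S.card := by
      by_contra! h
      obtain ⟨i, rfl⟩ := Finset.card_eq_one.1 (le_antisymm h hSne.card_pos)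
      exact hS₁ (hB₁.1.singleton_mem i)
    have hSu : S ≠ Finset.univ := fun h => hS₁ (h ▸ hB₁.2)
    obtain ⟨I, hI, J, hJ, hd, rfl⟩ :=
      exists_disjoint_union_of_isFlagPolytope hB₃ hflag₃ hS₃ hcard hSu
    -- A part of a splitting is a proper subset of the minimal element of B₃ \ B₁, so it cannot lie
    -- outside B₁.
    have hmem : ∀ X ∈ B₃, ∀ Y ∈ B₃, Disjoint X Y → X ∪ Y = I ∪ J → X ∈ B₁ := by
      intro X hX Y hY hXY h
      by_contra hX₁
      obtain ⟨j, hj⟩ := hB₃.1.nonempty_of_mem Y hY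
      have hsub : I ∪ J ⊆ X := hS.le_of_le (Finset.mem_sdiff.2 ⟨hX, hX₁⟩)
        (h ▸ Finset.subset_union_left)
      exact Finset.disjoint_right.1 hXY hj (hsub (h ▸ Finset.mem_union_right X hj))
    obtain ⟨B₂, hcl, hsplit⟩ := exists_isBuildingClosure_insert hB₁.1
      (hmem I hI J hJ hd rfl) (hmem J hJ I hI hd.symm (Finset.union_comm _ _))
    have hsub : B₁ ⊆ B₂ := (Finset.subset_insert _ _).trans hcl.1.2
    refine ⟨B₂, hcl, ⟨hsub, fun h => hS₁ (h (hcl.1.2 (Finset.mem_insert_self _ _)))⟩,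
      hcl.2 ⟨hB₃.1, Finset.insert_subset hS₃ hlt.1⟩,
      obtainedByCodimTwoShavings_of_split hB₁ hcl.1.1 hsub hsplit⟩
  refine ⟨?_, main⟩
  obtain ⟨S, hS⟩ := (B₃ \ B₁).exists_minimal (Finset.sdiff_nonempty.2 hlt.2)
  obtain ⟨B₂, hcl, h1, h2, h3⟩ := main S hS
  exact ⟨B₂, ⟨hcl.1.1, h1.1 hB₁.2⟩, h1, h2, h3⟩
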